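/- Let $k$ be a field of characteristic $p>0$, $R=k[x_1,\dots,x_n]$, $R'=k[[x_1,\dots,x_n]]$, let $I\subseteq R$ be a face ideal (an ideal generated by square-free monomials), and put $\widehat S=R'/IR'$. For an ideal $H$ and an integer $q$ let $H^{[q]}$ be the ideal generated by the $q$-th powers of the elements of $H$. Write $$(I^{[p]}:_R I)=I^{[p]}+J_p+\big((x^{\beta})^{p-1}\big),\qquad J_p=(m_1,\dots,m_r),\quad r\ge 0,$$ where $\beta\in\{0,1\}^n$ and each $m_\mu$ is a monomial all of whose exponents lie in $\{0,p-1,p\}$, with at least one exponent equal to $p$ and at least one equal to $p-1$. For $d\in\{0,1\}^n$ put $x^d=\prod_i x_i^{d_i}$, $Q_{d^+}=(x_j : d_j=0)\subseteq R'$, a prime ideal, and $$G_d=D(x^d)\cap V(Q_{d^+})\subseteq \operatorname{Spec}(R').$$ For a Noetherian ring $A$ and $P\in\operatorname{Spec}(A)$ let $\widehat{A_P}$ be the completion of the local ring $A_P$. For a module $M$ over a ring $A$ of characteristic $p$ let $\mathcal F(M)=\bigoplus_{e\ge 0}\mathcal F^e(M)$, where $\mathcal F^e(M)$ is the set of additive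 maps $\varphi:M\to M$ with $\varphi(ax)=a^{p^e}\varphi(x)$ for $a\in A$, $x\in M$, and the product of homogeneous elements is composition. For a local ring $A$ let $E_A$ be the injective hull of its residue field. Let $$U=\{P\in \operatorname{Spec}(\widehat S) : \mathcal F(E_{\widehat{\widehat S_P}})\text{ is a finitely generated } \widehat{\widehat S_P}\text{-algebra}\}.$$ Suppose that for some $d\in\{0,1\}^n$ there is a monomial $x^\sigma$ which is a minimal generator of the ideal $J_p\,\widehat{R'_{Q_{d^+}}}$ (it lies in this ideal but not in its product with the maximal ideal), such that $\sigma_a=0$, $\sigma_b=p-1$ and $\sigma_c=p$ for some indices $a,b,c$, where $x_c$ is one of the variables with $d_c=0$ (those that do not become units in $R'_{Q_{d^+}}$). Suppose also that $$x^\sigma\notin \big(I^{[p]}+(x^{\beta(p-1)})\big)\widehat{R'_{Q_{d^+}}}.$$ Then, identifying $\operatorname{Spec}(\widehat S)$ with $V(IR')\subseteq\operatorname{Spec}(R')$, $$G_d\cap V(IR')\subseteq U^c ,$$ that is, $\mathcal F(E_{\widehat{\widehat S_Q}})$ is not a finitely generated $\widehat{\widehat S_Q}$-algebra for any $Q\in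 G_d\cap V(IR')$. -/

import Mathlib

open scoped DirectSum

/-! ### Injective hulls -/

/-- `i : M → E` is an injective hull of the `R`-module `M`: `E` is an injective module and `i` is an
essential monomorphism, i.e. every nonzero submodule of `E` meets the image of `M` nontrivially.
It is unique up to isomorphism, and it exists by `exists_isInjectiveHull`. -/
structure IsInjectiveHull {R M E : Type*} [CommRing R] [AddCommGroup M] [Module R M]
    [AddCommGroup E] [Module R E] (i : M →ₗ[R] E) : Prop where
  injective_module : Module.Injective R E
  injective_map : Function.Injective i
  essential : ∀ N : Submodule R E, N ≠ ⊥ → N ⊓ LinearMap.range i ≠ ⊥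

/-- Every module has an injective hull (in the same universe). -/
theorem exists_isInjectiveHull.{u} (R : Type u) [CommRing R] (M : Type u) [AddCommGroup M]
    [Module R M] : ∃ (E : Type u) (_ : AddCommGroup E) (_ : Module R E) (i : M →ₗ[R] E),
      IsInjectiveHull i := by
  classical
  -- an injective module containing `M`
  obtain ⟨F, _, _, i, hF, hi⟩ : ∃ (F : Type u) (_ : AddCommGroup F) (_ : Module R F)
      (i : M →ₗ[R] F), Module.Injective R F ∧ Function.Injective i := by
    obtain ⟨⟨J, hJ, f, hf⟩⟩ := (ModuleCat.enoughInjectives.{u} R).presentation (ModuleCat.of R M)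
    exact ⟨J, inferInstance, inferInstance, f.hom,
      Module.injective_module_of_injective_object R J, (ModuleCat.mono_iff_injective f).1 hf⟩
  -- a maximal essential extension inside it
  obtain ⟨E, hE0, hE⟩ := zorn_le_nonempty₀
    {E : Submodule R F | LinearMap.range i ≤ E ∧
      ∀ x ∈ E, x ≠ 0 → ∃ r : R, r • x ≠ 0 ∧ r • x ∈ LinearMap.range i}
    (by
      intro c hc hch y hy
      refine ⟨sSup c, ⟨(hc hy).1.trans (le_sSup hy), fun x hx hx0 => ?_⟩, fun z hz => le_sSup hz⟩
      obtain ⟨z, hz, hxz⟩ := (Submodule.mem_sSup_of_directed ⟨y, hy⟩ hch.directedOn).1 hx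
      exact (hc hz).2 x hxz hx0)
    (LinearMap.range i) ⟨le_rfl, fun x hx hx0 => ⟨1, by simpa using hx0, by simpa using hx⟩⟩
  -- a maximal submodule meeting it trivially
  obtain ⟨C, -, hC⟩ := zorn_le_nonempty₀
    {C : Submodule R F | ∀ x ∈ C, x ∈ E → x = 0}
    (by
      intro c hc hch y hy
      refine ⟨sSup c, fun x hx hxE => ?_, fun z hz => le_sSup hz⟩
      obtain ⟨z, hz, hxz⟩ := (Submodule.mem_sSup_of_directed ⟨y, hy⟩ hch.directedOn).1 hx
      exact hc hz x hxz hxE)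
    ⊥ (fun x hx _ => by simpa using hx)
  have hC0 : ∀ x ∈ C, x ∈ E → x = 0 := hC.prop
  obtain ⟨h, hh⟩ := Module.Injective.extension_property R F E (F ⧸ C) (C.mkQ ∘ₗ E.subtype)
    (by
      rw [injective_iff_map_eq_zero]
      intro x hx
      have : (x : F) ∈ C := by simpa using hx
      exact Subtype.ext (hC0 x this x.2)) E.subtype
  have hid : ∀ x ∈ E, h (C.mkQ x) = x := fun x hx => LinearMap.congr_fun hh ⟨x, hx⟩
  have hkey : ∀ z, z ∉ C → ∃ r : R, r • h (C.mkQ z) ≠ 0 ∧ r • h (C.mkQ z) ∈ E := by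
    intro z hz
    by_contra hcon
    push Not at hcon
    apply hz
    have hmem : ∀ x ∈ C ⊔ R ∙ z, x ∈ E → x = 0 := by
      intro x hx hxE
      obtain ⟨c, hc, w, hw, rfl⟩ := Submodule.mem_sup.1 hx
      obtain ⟨r, rfl⟩ := Submodule.mem_span_singleton.1 hw
      have h1 : r • h (C.mkQ z) = c + r • z := by
        rw [← hid _ hxE, map_add, map_add, map_smul, map_smul]
        simp [(Submodule.Quotient.mk_eq_zero C).2 hc]
      by_contra hne
      exact hcon r (h1 ▸ hne) (h1 ▸ hxE)
    exact hC.le_of_ge hmem le_sup_left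
      (Submodule.mem_sup_right (Submodule.mem_span_singleton_self z))
  have hrange : LinearMap.range (h ∘ₗ C.mkQ) ≤ E := by
    refine hE.le_of_ge (y := LinearMap.range (h ∘ₗ C.mkQ)) ⟨?_, ?_⟩ ?_
    · exact fun x hx => ⟨x, hid x (hE0 hx)⟩
    · rintro _ ⟨z, rfl⟩ hx0
      obtain ⟨r, hr0, hrE⟩ := hkey z (fun hz => hx0 (by
        simp [(Submodule.Quotient.mk_eq_zero C).2 hz]))
      obtain ⟨s, hs0, hs⟩ := hE.prop.2 _ hrE hr0
      exact ⟨s * r, by simpa [mul_smul] using hs0, by simpa [mul_smul] using hs⟩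
    · exact fun x hx => ⟨x, hid x hx⟩
  let ρ : F →ₗ[R] E := (h ∘ₗ C.mkQ).codRestrict E fun x => hrange ⟨x, rfl⟩
  refine ⟨E, inferInstance, inferInstance, i.codRestrict E fun x => hE0 ⟨x, rfl⟩, ⟨⟨?_⟩, ?_, ?_⟩⟩
  · intro X Y _ _ _ _ f hf g
    obtain ⟨g', hg'⟩ := hF.out f hf (E.subtype ∘ₗ g)
    refine ⟨ρ ∘ₗ g', fun x => Subtype.ext ?_⟩
    have := hid (g x) (g x).2
    simpa [ρ, hg'] using this
  · exact fun x y hxy => hi (congrArg Subtype.val hxy)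
  · intro N hN hbot
    obtain ⟨x, hx, hx0⟩ := (Submodule.ne_bot_iff N).1 hN
    obtain ⟨r, hr0, m, hm⟩ := hE.prop.2 x x.2 (fun h0 => hx0 (Subtype.ext h0))
    have h1 : r • x ∈ N ⊓ LinearMap.range (i.codRestrict E fun x => hE0 ⟨x, rfl⟩) :=
      ⟨N.smul_mem r hx, m, Subtype.ext hm⟩
    rw [hbot, Submodule.mem_bot] at h1
    exact hr0 (congrArg Subtype.val h1)

/-! ### Frobenius algebras -/

/-- `𝓕ᵉ(M)`: the additive maps `φ : M → M` with `φ (r x) = r ^ (p ^ e) φ (x)`. -/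
def frobeniusMaps (p : ℕ) (R M : Type*) [CommRing R] [AddCommGroup M] [Module R M] (e : ℕ) :
    AddSubgroup (AddMonoid.End M) where
  carrier := {φ | ∀ (r : R) (x : M), φ (r • x) = r ^ (p ^ e) • φ x}
  add_mem' {φ ψ} hφ hψ r x := by
    change φ (r • x) + ψ (r • x) = r ^ (p ^ e) • (φ x + ψ x)
    rw [hφ, hψ, smul_add]
  zero_mem' r x := (smul_zero _).symm
  neg_mem' {φ} hφ r x := by
    change -φ (r • x) = r ^ (p ^ e) • (-φ x)
    rw [hφ, smul_neg]

/-- Composition sends `𝓕ᵉ(M) × 𝓕ᵉ'(M)` to `𝓕ᵉ⁺ᵉ'(M)`. -/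
instance frobeniusMaps.gradedMonoid (p : ℕ) (R M : Type*) [CommRing R] [AddCommGroup M]
    [Module R M] : SetLike.GradedMonoid (frobeniusMaps p R M) where
  one_mem r x := by
    change r • x = r ^ (p ^ 0) • x
    simp
  mul_mem e e' φ ψ hφ hψ r x := by
    change φ (ψ (r • x)) = r ^ (p ^ (e + e')) • φ (ψ x)
    rw [hψ, hφ, ← pow_mul, pow_add, mul_comm (p ^ e)]

/-- The Frobenius algebra `𝓕(M) = ⨁_{e ≥ 0} 𝓕ᵉ(M)`: the external direct sum, whose product is
`φ · ψ = φ ∘ ψ` on homogeneous elements. -/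
abbrev FrobeniusAlgebra (p : ℕ) (R M : Type*) [CommRing R] [AddCommGroup M] [Module R M] : Type _ :=
  ⨁ e, frobeniusMaps p R M e

/-- The structure map `R → 𝓕⁰(M) ⊆ 𝓕(M)`, sending `r` to multiplication by `r`. -/
noncomputable def FrobeniusAlgebra.scalar (p : ℕ) (R M : Type*) [CommRing R] [AddCommGroup M]
    [Module R M] (r : R) : FrobeniusAlgebra p R M :=
  DirectSum.of (fun e => frobeniusMaps p R M e) 0
    ⟨DistribSMul.toAddMonoidHom M r, fun s x => by
      change r • s • x = s ^ (p ^ 0) • r • x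
      rw [pow_zero, pow_one, smul_comm]⟩

/-- `𝓕(M)` is a finitely generated `R`-algebra: finitely many elements together with the scalars
from `R` generate `𝓕(M)` as a (noncommutative) ring. -/
def FrobeniusAlgebra.IsFinitelyGenerated (p : ℕ) (R M : Type*) [CommRing R] [AddCommGroup M]
    [Module R M] : Prop :=
  ∃ T : Finset (FrobeniusAlgebra p R M),
    Subring.closure (Set.range (FrobeniusAlgebra.scalar p R M) ∪ (T : Set _)) = ⊤

/-- For a local ring `(R, 𝔪)` with injective hull `E` of its residue field, the Frobenius algebra
`𝓕(E)` is a finitely generated `R`-algebra. -/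
def HasFGFrobeniusAlgebra.{u} (p : ℕ) (R : Type u) [CommRing R] [IsLocalRing R] : Prop :=
  ∃ (E : Type u) (_ : AddCommGroup E) (_ : Module R E)
    (i : IsLocalRing.ResidueField R →ₗ[R] E),
    IsInjectiveHull i ∧ FrobeniusAlgebra.IsFinitelyGenerated p R E

/-- The completed local ring of `A` at the prime `P`: the completion of `A_P` at its maximal
ideal. -/
abbrev CompletedLocalRing {A : Type*} [CommRing A] (P : PrimeSpectrum A) : Type _ :=
  AdicCompletion (IsLocalRing.maximalIdeal (Localization.AtPrime P.asIdeal))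
    (Localization.AtPrime P.asIdeal)

/-- The finitely generated locus `U ⊆ Spec A`: the primes `P` such that the Frobenius algebra of
the injective hull of the residue field of the completed local ring of `A` at `P` is finitely
generated over that ring. -/
def fgLocus (p : ℕ) (A : Type*) [CommRing A] [IsNoetherianRing A] : Set (PrimeSpectrum A) :=
  {P | HasFGFrobeniusAlgebra p (CompletedLocalRing P)}

/-! ### Face ideals, Frobenius powers -/

/-- A face ideal: an ideal generated by square-free monomials. -/
def IsFaceIdeal {n : ℕ} {k : Type*} [Field k] (I : Ideal (MvPolynomial (Fin n) k)) : Prop :=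
  ∃ 𝒜 : Set (Finset (Fin n)),
    I = Ideal.span ((fun s : Finset (Fin n) => ∏ i ∈ s, MvPolynomial.X i) '' 𝒜)

/-- The Frobenius power `I^[q]`, generated by the `q`-th powers of the elements of `I`. -/
def frobeniusPower {A : Type*} [CommRing A] (I : Ideal A) (q : ℕ) : Ideal A :=
  Ideal.span ((fun a => a ^ q) '' (I : Set A))

/-- The monomial `x ^ σ` of `k[x₁, …, xₙ]`. -/
noncomputable def xPow {n : ℕ} (k : Type*) [Field k] (σ : Fin n → ℕ) :
    MvPolynomial (Fin n) k :=
  ∏ i, MvPolynomial.X i ^ σ i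

/-! ### The strata of the spectrum of the power series ring -/

/-- The set of variables `x_j` of `k⟦x₁, …, xₙ⟧` with `d_j = 0`, that is, the support of `d⁺`. -/
def varsOffSupport {n : ℕ} (k : Type*) [Field k] (d : Fin n → Fin 2) :
    Set (MvPowerSeries (Fin n) k) :=
  (fun j => MvPowerSeries.X j) '' {j | d j = 0}

/-- `G_d = D(x^d) ∩ V(x_j : d_j = 0)` in the spectrum of `k⟦x₁, …, xₙ⟧`. -/
def stratum {n : ℕ} (k : Type*) [Field k] (d : Fin n → Fin 2) :
    Set (PrimeSpectrum (MvPowerSeries (Fin n) k)) :=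
  (PrimeSpectrum.basicOpen (∏ i, MvPowerSeries.X i ^ (d i : ℕ) : MvPowerSeries (Fin n) k) :
      Set (PrimeSpectrum (MvPowerSeries (Fin n) k))) ∩
    PrimeSpectrum.zeroLocus (varsOffSupport k d)

theorem mem_span_X_of_coeff_eq_zero {n : ℕ} {k : Type*} [Field k] (s : Finset (Fin n))
    (f : MvPowerSeries (Fin n) k)
    (hf : ∀ m : Fin n →₀ ℕ, (∀ j ∈ s, m j = 0) → MvPowerSeries.coeff m f = 0) :
    f ∈ Ideal.span ((fun j => (MvPowerSeries.X j : MvPowerSeries (Fin n) k)) '' s) := by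
  classical
  induction s using Finset.induction_on generalizing f with
  | empty =>
    have : f = 0 := by
      ext m
      simpa using hf m (by simp)
    simp [this]
  | insert a s ha ih =>
    let f₂ : MvPowerSeries (Fin n) k := fun m => if m a = 0 then MvPowerSeries.coeff m f else 0
    have hf₂ : ∀ m, MvPowerSeries.coeff m f₂ = if m a = 0 then MvPowerSeries.coeff m f else 0 :=
      fun m => rfl
    have h1 : (MvPowerSeries.X a : MvPowerSeries (Fin n) k) ∣ f - f₂ := by
      rw [MvPowerSeries.X_dvd_iff]
      intro m hm
      simp [hf₂, hm]
    have h2 : f₂ ∈ Ideal.span ((fun j => (MvPowerSeries.X j : MvPowerSeries (Fin n) k)) '' s) := by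
      apply ih
      intro m hm
      rw [hf₂]
      split_ifs with h0
      · exact hf m (by simpa [h0] using hm)
      · rfl
    rw [← sub_add_cancel f f₂]
    refine Ideal.add_mem _ ?_ (Ideal.span_mono (Set.image_mono (by simp)) h2)
    exact Ideal.mem_of_dvd _ h1 (Ideal.subset_span ⟨a, by simp, rfl⟩)

/-- The ideal `Q_{d⁺}` generated by the variables `x_j` with `d_j = 0` is prime. -/
theorem isPrime_span_varsOffSupport {n : ℕ} (k : Type*) [Field k] (d : Fin n → Fin 2) :
    (Ideal.span (varsOffSupport k d)).IsPrime := by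
  classical
  let e : {i : Fin n // d i ≠ 0} ↪ Fin n := Function.Embedding.subtype _
  have : Ideal.span (varsOffSupport k d) = RingHom.ker (MvPowerSeries.killCompl (R := k) e) := by
    apply le_antisymm
    · rw [Ideal.span_le]
      rintro _ ⟨j, hj, rfl⟩
      exact MvPowerSeries.killCompl_X_eq_zero (by simpa [e] using hj)
    · intro f hf
      have := mem_span_X_of_coeff_eq_zero (Finset.univ.filter fun j => d j = 0) f (by
        intro m hm
        have hm' : m ∈ Set.range (Finsupp.embDomain e) := by
          rw [Finsupp.mem_range_embDomain_iff]
          intro j hj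
          have : d j ≠ 0 := fun h0 => Finsupp.mem_support_iff.1 hj (hm j (by simp [h0]))
          exact ⟨⟨j, this⟩, rfl⟩
        obtain ⟨m', rfl⟩ := hm'
        rw [← MvPowerSeries.coeff_killCompl, (RingHom.mem_ker).1 hf, map_zero])
      simpa [varsOffSupport] using this
  have hdom : IsDomain (MvPowerSeries {i : Fin n // d i ≠ 0} k) := NoZeroDivisors.to_isDomain _
  rw [this]
  exact RingHom.ker_isPrime _

/-- The prime `Q_{d⁺} = (x_j : d_j = 0)` of `k⟦x₁, …, xₙ⟧`. -/
noncomputable def coordPrime {n : ℕ} (k : Type*) [Field k] (d : Fin n → Fin 2) :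
    PrimeSpectrum (MvPowerSeries (Fin n) k) :=
  ⟨Ideal.span (varsOffSupport k d), isPrime_span_varsOffSupport k d⟩

/-! ### Passing from polynomials to the completed local rings -/

/-- The map from `k[x₁, …, xₙ]` to the completed local ring of `k⟦x₁, …, xₙ⟧` at `Q_{d⁺}`. -/
noncomputable def toCompletedLocalRing {n : ℕ} (k : Type*) [Field k] (d : Fin n → Fin 2) :
    MvPolynomial (Fin n) k →+* CompletedLocalRing (coordPrime k d) :=
  (algebraMap (MvPowerSeries (Fin n) k) (CompletedLocalRing (coordPrime k d))).comp
    MvPolynomial.coeToMvPowerSeries.ringHom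

/-- `x` is a minimal generator of the ideal `J` of a local ring: it belongs to some minimal
generating set of `J`, equivalently (by Nakayama, `J` being finitely generated) it lies in `J` but
not in `𝔪 J`. -/
def IsMinimalGenerator {A : Type*} [CommRing A] [IsLocalRing A] (J : Ideal A) (x : A) : Prop :=
  x ∈ J ∧ x ∉ IsLocalRing.maximalIdeal A * J

/-- The ideal `I k⟦x₁, …, xₙ⟧` generated by `I ⊆ k[x₁, …, xₙ]` in the power series ring. -/
noncomputable abbrev extendIdeal {n : ℕ} {k : Type*} [Field k] (I : Ideal (MvPolynomial (Fin n) k)) :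
    Ideal (MvPowerSeries (Fin n) k) :=
  I.map MvPolynomial.coeToMvPowerSeries.ringHom

/-- The completion `Ŝ = k⟦x₁, …, xₙ⟧ / I k⟦x₁, …, xₙ⟧` of the face ring `S = k[x₁, …, xₙ] / I`
at the ideal of the variables. -/
abbrev CompletedFaceRing {n : ℕ} {k : Type*} [Field k] (I : Ideal (MvPolynomial (Fin n) k)) :
    Type _ :=
  MvPowerSeries (Fin n) k ⧸ extendIdeal I

open scoped DirectSum


/-! ### Divisibility in injective modules -/

/-! Let `B` be the completed local ring of the face ring at a point of the stratum. Variables with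
`d j ≠ 0` are units there, so only those with `d j = 0` matter. Let `V₁`, `V₂` be the sets of such
variables where `σ` equals `p - 1`, `p`, and write `q = p ^ e`. The obstruction to finite generation
is a test that products of maps of positive degree always fail to detect, while in each positive
degree some map is detected.

The test uses the set `H` of those `η ∈ E` with `x i ^ 2 • η = 0` on `V₂` and `x i • η = 0`
elsewhere, and the monomial `t e` with exponent `0` on `V₁` and `q - 1` elsewhere. Replacing the
values `p - 1`, `p` of `σ` by `q - 1`, `q` gives `blowExp`; its monomial multiplies the face ideal
into its `q`-th Frobenius power, and no proper divisor does (`isCriticalExp_levelSet`).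

Detection: multiplying a Cartier map on power series by this monomial lets it descend to `B`, where
it sends `t e` to `∏ i ∈ V₂, x i` up to a unit. Some `η ∈ H` is carried by this product to a nonzero
socle element, and the cogenerator property of `E` turns the Cartier map into a `φ ∈ 𝓕ᵉ(E)` with `t
e • φ η ≠ 0`.

Vanishing: criticality forces `t e • ψ η` to be killed by every variable, for `ψ ∈ 𝓕ᵉ(E)` and `η ∈
H` (`smul_coExp_smul_eq_zero`). Such an element is `x c • ζ` with `c ∈ V₂` and `ζ ∈ H`; a second map
of positive degree takes out `x c ^ q`, and this kills the result (`comp_eq_zero`). A finitely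
generated algebra consists, in large degree, of sums of products for which the test vanishes
(`exists_degree`), which contradicts detection. -/

theorem Module.Injective.exists_smul_eq_of_regular.{u} {B E : Type u} [CommRing B] [AddCommGroup E]
    [Module B E] [Module.Injective B E] (𝔟 : Ideal B) (a : B)
    (ha : ∀ r, a * r ∈ 𝔟 → r ∈ 𝔟) (g : E) (hg : ∀ b ∈ 𝔟, b • g = 0) :
    ∃ η : E, (∀ b ∈ 𝔟, b • η = 0) ∧ a • η = g := by
  -- Elements of `E` killed by `𝔟` are the maps `B ⧸ 𝔟 → E`. Multiplication by `a` is injective on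
  -- `B ⧸ 𝔟`, hence surjective on these maps since `E` is injective.
  let f : (B ⧸ 𝔟) →ₗ[B] (B ⧸ 𝔟) := LinearMap.lsmul B (B ⧸ 𝔟) a
  have hf : Function.Injective f := by
    rw [injective_iff_map_eq_zero]
    intro z hz
    obtain ⟨r, rfl⟩ := Ideal.Quotient.mk_surjective z
    exact Ideal.Quotient.eq_zero_iff_mem.2 (ha r (Ideal.Quotient.eq_zero_iff_mem.1 hz))
  let g' : (B ⧸ 𝔟) →ₗ[B] E := Submodule.liftQ 𝔟 (LinearMap.toSpanSingleton B E g)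
    (fun b hb => by simpa using hg b hb)
  obtain ⟨h, hh⟩ := Module.Injective.out (R := B) (Q := E) f hf g'
  have key : ∀ b : B, b • h (Ideal.Quotient.mk 𝔟 1) = h (Ideal.Quotient.mk 𝔟 b) := by
    intro b
    rw [← map_smul]
    congr 1
    rw [← Ideal.Quotient.algebraMap_eq, map_one, Algebra.smul_def, mul_one]
  refine ⟨h (Ideal.Quotient.mk 𝔟 1), fun b hb => ?_, ?_⟩
  · rw [key, Ideal.Quotient.eq_zero_iff_mem.2 hb, map_zero]
  · rw [key]
    have := hh (Ideal.Quotient.mk 𝔟 1)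
    have h1 : f (Ideal.Quotient.mk 𝔟 1) = Ideal.Quotient.mk 𝔟 a := by
      change Ideal.Quotient.mk 𝔟 (a * 1) = _
      rw [mul_one]
    rw [h1] at this
    rw [this]
    change (1 : B) • g = g
    exact one_smul _ _

/-! ### Monomials -/

section Monomials

variable {ι B : Type*} [Fintype ι] [CommRing B]

/-- The monomial `∏ i, x i ^ a i`. -/
def monom (x : ι → B) (a : ι → ℕ) : B := ∏ i, x i ^ a i

theorem monom_add (x : ι → B) (a b : ι → ℕ) : monom x (a + b) = monom x a * monom x b := by
  simp [monom, pow_add, Finset.prod_mul_distrib]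

theorem monom_mul (x : ι → B) (q : ℕ) (a : ι → ℕ) :
    monom x (fun i => q * a i) = monom x a ^ q := by
  simp only [monom, ← Finset.prod_pow]
  exact Finset.prod_congr rfl fun i _ => by rw [mul_comm, pow_mul]

theorem monom_indicator [DecidableEq ι] (x : ι → B) (s : Finset ι) :
    monom x (fun i => if i ∈ s then 1 else 0) = ∏ i ∈ s, x i := by
  simp [monom, Finset.prod_ite_mem, pow_ite]

theorem monom_single [DecidableEq ι] (x : ι → B) (i : ι) (a : ℕ) :
    monom x (Pi.single i a) = x i ^ a := by
  rw [monom, Finset.prod_eq_single i]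
  · simp
  · intro j _ hj
    simp [hj]
  · simp

theorem monom_dvd (x : ι → B) {a b : ι → ℕ} (h : ∀ i, a i ≤ b i) : monom x a ∣ monom x b := by
  refine ⟨monom x (b - a), ?_⟩
  rw [← monom_add]
  congr 1
  funext i
  have := h i
  simp only [Pi.add_apply, Pi.sub_apply]
  omega

theorem pow_dvd_monom (x : ι → B) {b : ι → ℕ} {i : ι} {a : ℕ} (h : a ≤ b i) :
    x i ^ a ∣ monom x b :=
  (pow_dvd_pow _ h).trans (Finset.dvd_prod_of_mem (fun i => x i ^ b i) (Finset.mem_univ i))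

theorem smul_eq_zero_of_dvd {E : Type*} [AddCommGroup E] [Module B E] {a b : B} (h : a ∣ b)
    {η : E} (ha : a • η = 0) : b • η = 0 := by
  obtain ⟨c, rfl⟩ := h
  rw [mul_comm, mul_smul, ha, smul_zero]

end Monomials

/-! ### Exponents -/

section Exponents

variable {ι : Type*} [DecidableEq ι]

/-- The set `V` of vertices meets every set of the family `𝒜`. -/
def IsCover (𝒜 : Set (Finset ι)) (V : Finset ι) : Prop := ∀ s ∈ 𝒜, ∃ i ∈ s, i ∈ V

/-- The exponent with value `q` on `V₂`, `q - 1` on `V₁` and `0` elsewhere. -/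
def blowExp (V₁ V₂ : Finset ι) (q : ℕ) (i : ι) : ℕ :=
  if i ∈ V₂ then q else if i ∈ V₁ then q - 1 else 0

/-- The exponent with value `0` on `V₁` and `q - 1` elsewhere. -/
def coExp (V₁ : Finset ι) (q : ℕ) (i : ι) : ℕ := if i ∈ V₁ then 0 else q - 1

/-- The exponent with value `2` on `V₂` and `1` elsewhere. -/
def nilExp (V₂ : Finset ι) (i : ι) : ℕ := if i ∈ V₂ then 2 else 1

/-- The two exponents sum to one less than the exponent at which `x i` kills `ψ η`, for `ψ` of
Frobenius exponent `q` and `η` killed by `x i ^ nilExp V₂ i`. -/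
theorem blowExp_add_coExp {V₁ V₂ : Finset ι} (h : Disjoint V₁ V₂) {q : ℕ} (hq : 1 ≤ q) (i : ι) :
    blowExp V₁ V₂ q i + coExp V₁ q i + 1 = q * nilExp V₂ i := by
  have : i ∈ V₁ → i ∉ V₂ := fun hi => Finset.disjoint_left.1 h hi
  unfold blowExp coExp nilExp
  split_ifs <;> first | omega | tauto

/-- This factorisation moves the part for `q'` inside a map of Frobenius exponent `q`. -/
theorem coExp_mul (V₁ : Finset ι) {q q' : ℕ} (hq : 1 ≤ q) (hq' : 1 ≤ q') :
    coExp V₁ (q * q') = coExp V₁ q + fun i => q * coExp V₁ q' i := by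
  funext i
  obtain ⟨q', rfl⟩ := Nat.exists_eq_add_of_le hq'
  simp only [coExp, Pi.add_apply]
  split_ifs
  · simp
  · have h : q * (1 + q') = q + q * q' := by ring
    rw [h, Nat.add_sub_cancel_left]
    omega

/-- No monomial strictly dividing the one of exponent `blowExp V₁ V₂ q` multiplies the face ideal
of `𝒜` into its `q`-th Frobenius power. -/
def IsCriticalExp (𝒜 : Set (Finset ι)) [Fintype ι] (V₁ V₂ : Finset ι) (q : ℕ) : Prop :=
  ∀ u : ι → ℕ, (∀ i, u i ≤ blowExp V₁ V₂ q i) → u ≠ blowExp V₁ V₂ q →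
    ∃ s ∈ 𝒜, IsCover 𝒜 {i | u i + (if i ∈ s then 1 else 0) < q}

end Exponents

/-- The elements `x i` behave in `B` like variables modulo the face ideal of `𝒜`. -/
structure IsFaceSystem {ι B : Type*} [CommRing B] (𝒜 : Set (Finset ι)) (x : ι → B) : Prop where
  prod_eq_zero : ∀ s ∈ 𝒜, ∏ i ∈ s, x i = 0
  regular : ∀ (T : Finset ι) (a : ι → ℕ) (j : ι), j ∉ T →
    (∀ s ∈ 𝒜, ∃ i ∈ s, i ∈ T ∧ a i ≤ 1) → ∀ r : B,
      x j * r ∈ Ideal.span ((fun i => x i ^ a i) '' (T : Set ι)) →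
        r ∈ Ideal.span ((fun i => x i ^ a i) '' (T : Set ι))

/-! ### Annihilation in an injective module over a face system -/

namespace IsFaceSystem

theorem regular_prod {ι B : Type*} [CommRing B] {𝒜 : Set (Finset ι)} {x : ι → B}
    (hx : IsFaceSystem 𝒜 x) (V C : Finset ι) (hV : IsCover 𝒜 V) (hC : Disjoint C V) (r : B)
    (hr : (∏ i ∈ C, x i) * r ∈ Ideal.span (x '' (V : Set ι))) :
    r ∈ Ideal.span (x '' (V : Set ι)) := by
  classical
  induction C using Finset.induction_on generalizing r with
  | empty => simpa using hr
  | insert j C hj ih =>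
    rw [Finset.disjoint_insert_left] at hC
    rw [Finset.prod_insert hj, mul_assoc] at hr
    apply ih hC.2
    have := hx.regular V (fun _ => 1) j hC.1 (fun s hs => by
      obtain ⟨i, hi, hi'⟩ := hV s hs
      exact ⟨i, hi, hi', le_rfl⟩)
    simp only [pow_one] at this
    exact this _ hr

universe u v

variable {ι : Type v} {B E : Type u} [Fintype ι] [DecidableEq ι] [CommRing B] [AddCommGroup E]
  [Module B E] {𝒜 : Set (Finset ι)} {x : ι → B} {V₁ V₂ : Finset ι}

theorem smul_span_eq_zero {S : Set B} {η : E} (h : ∀ b ∈ S, b • η = 0) :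
    ∀ b ∈ Ideal.span S, b • η = 0 := by
  intro b hb
  have : Ideal.span S ≤ LinearMap.ker (LinearMap.toSpanSingleton B E η) :=
    Ideal.span_le.2 fun b hb => by simpa using h b hb
  simpa using this hb

/-- Divide by the variables of `C` one at a time. The complement of `V₂` already meets every face,
so the powers of the other variables generate an ideal modulo which `x j` is regular. Afterwards `x
j` no longer kills the element, but `x j ^ 2` does. -/
theorem exists_prod_smul_eq [Module.Injective B E] (hx : IsFaceSystem 𝒜 x)
    (hV : IsCover 𝒜 V₂ᶜ) (g : E) (hg : ∀ i, x i • g = 0) (C : Finset ι) (hC : C ⊆ V₂) :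
    ∃ η : E, (∀ i, x i ^ nilExp C i • η = 0) ∧ (∏ i ∈ C, x i) • η = g := by
  induction C using Finset.induction_on with
  | empty => exact ⟨g, by simpa [nilExp] using hg, by simp⟩
  | insert j C hj ih =>
    rw [Finset.insert_subset_iff] at hC
    obtain ⟨η, hη, hηg⟩ := ih hC.2
    obtain ⟨η', hη', hjη⟩ := Module.Injective.exists_smul_eq_of_regular
      (Ideal.span ((fun i => x i ^ nilExp C i) '' ((Finset.univ.erase j : Finset ι) : Set ι)))
      (x j) (hx.regular _ _ j (by simp) (fun s hs => by
        obtain ⟨i, hi, hi'⟩ := hV s hs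
        rw [Finset.mem_compl] at hi'
        refine ⟨i, hi, by simp; rintro rfl; exact hi' hC.1, ?_⟩
        have : i ∉ C := fun h => hi' (hC.2 h)
        simp [nilExp, this]))
      η (smul_span_eq_zero (by rintro _ ⟨i, -, rfl⟩; exact hη i))
    refine ⟨η', fun i => ?_, ?_⟩
    · by_cases hij : i = j
      · subst hij
        have h2 : nilExp (insert i C) i = 1 + 1 := by simp [nilExp]
        have h1 := hη i
        rw [show nilExp C i = 1 by simp [nilExp, hj], pow_one] at h1
        rw [h2, pow_succ, pow_one, mul_smul, hjη, h1]
      · have : nilExp (insert j C) i = nilExp C i := by simp [nilExp, hij]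
        rw [this]
        exact hη' _ (Ideal.subset_span ⟨i, by simpa using hij, rfl⟩)
    · rw [Finset.prod_insert hj, mul_comm, mul_smul, hjη, hηg]

/-- If `x j • y ≠ 0`, the quotient of the critical monomial by a suitable multiple of `x j` fails to
multiply some face `s` into the Frobenius power. The variables witnessing the failure allow `ψ η` to
be traded for `ψ η'`, with a coefficient divisible by `∏ i ∈ s, x i = 0`. -/
theorem smul_coExp_smul_eq_zero [Module.Injective B E] (hx : IsFaceSystem 𝒜 x)
    (h12 : Disjoint V₁ V₂) {q : ℕ} (hq : 2 ≤ q) (hcrit : IsCriticalExp 𝒜 V₁ V₂ q)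
    (ψ : E →+ E) (hψ : ∀ (r : B) (η : E), ψ (r • η) = r ^ q • ψ η) (η : E)
    (hη : ∀ i, x i ^ nilExp V₂ i • η = 0) (j : ι) :
    x j • monom x (coExp V₁ q) • ψ η = 0 := by
  by_contra hne
  set y := monom x (coExp V₁ q) • ψ η with hy
  have hbound : ∀ i, x i ^ (blowExp V₁ V₂ q i + 1) • y = 0 := by
    intro i
    rw [hy, ← mul_smul]
    have h1 : x i ^ (q * nilExp V₂ i) • ψ η = 0 := by
      rw [mul_comm, pow_mul, ← hψ, hη, map_zero]
    refine smul_eq_zero_of_dvd ?_ h1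
    rw [← blowExp_add_coExp h12 (by omega) i, add_right_comm, pow_add]
    exact mul_dvd_mul_left _ (pow_dvd_monom x le_rfl)
  have hle : ∀ a : ι → ℕ, monom x a • y ≠ 0 → ∀ i, a i ≤ blowExp V₁ V₂ q i := by
    intro a ha i
    by_contra hlt
    exact ha (smul_eq_zero_of_dvd (pow_dvd_monom x (by omega)) (hbound i))
  obtain ⟨a, ⟨ha, haj⟩, hmax⟩ : ∃ a : ι → ℕ, (monom x a • y ≠ 0 ∧ 1 ≤ a j) ∧
      ∀ b : ι → ℕ, monom x b • y ≠ 0 ∧ 1 ≤ b j → ¬ a < b := by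
    have hfin : {a : ι → ℕ | monom x a • y ≠ 0 ∧ 1 ≤ a j}.Finite :=
      (Set.finite_Iic (blowExp V₁ V₂ q)).subset fun a ha i => hle a ha.1 i
    obtain ⟨a, ha⟩ := hfin.exists_maximal
      ⟨Pi.single j 1, by simpa [monom_single] using hne, by simp⟩
    exact ⟨a, ha.1, fun b hb hab => hab.not_ge (ha.2 hb hab.le)⟩
  set u : ι → ℕ := fun i => blowExp V₁ V₂ q i - a i with hu
  obtain ⟨s, hs, hcov⟩ := hcrit u (fun i => Nat.sub_le _ _) (fun h => by
    have h1 := congrFun h j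
    have h2 := hle a ha j
    simp only [hu] at h1
    omega)
  -- The places where `x ^ u * ∏ i ∈ s, x i` has exponent below `q`. They meet every face, so
  -- variables outside `V'` are regular modulo `V'`. The factor over `A` makes `η` killed by `V'`,
  -- and `C` collects variables by which the result can be divided.
  set V' : Finset ι := {i | u i + (if i ∈ s then 1 else 0) < q} with hV'
  have hmemV' : ∀ i, i ∈ V' ↔ u i + (if i ∈ s then 1 else 0) < q := by simp [hV']
  set A := V' ∩ V₂ with hA
  set C := V₂ᶜ \ V' with hC
  obtain ⟨η', -, hη'⟩ := Module.Injective.exists_smul_eq_of_regular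
    (Ideal.span (x '' (V' : Set ι))) (∏ i ∈ C, x i)
    (hx.regular_prod V' C hcov Finset.sdiff_disjoint) ((∏ i ∈ A, x i) • η)
    (smul_span_eq_zero (by
      rintro _ ⟨i, hi, rfl⟩
      by_cases h2 : i ∈ V₂
      · rw [← mul_smul]
        refine smul_eq_zero_of_dvd ?_ (hη i)
        rw [show nilExp V₂ i = 1 + 1 by simp [nilExp, h2], pow_succ, pow_one]
        exact mul_dvd_mul_left _ (Finset.dvd_prod_of_mem _ (Finset.mem_inter.2 ⟨hi, h2⟩))
      · have := hη i
        rw [show nilExp V₂ i = 1 by simp [nilExp, h2], pow_one] at this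
        rw [smul_comm, this, smul_zero]))
  have hψ' : monom x (fun i => q * if i ∈ C then 1 else 0) • ψ η' =
      monom x (fun i => q * if i ∈ A then 1 else 0) • ψ η := by
    rw [monom_mul, monom_mul, monom_indicator, monom_indicator, ← hψ, ← hψ, hη']
  have hbc := blowExp_add_coExp h12 (show 1 ≤ q by omega)
  have hblow : ∀ i, i ∉ V₂ → blowExp V₁ V₂ q i ≤ q - 1 := by
    intro i hi
    unfold blowExp
    split_ifs <;> omega
  have hblow' : ∀ i, blowExp V₁ V₂ q i ≤ q := by
    intro i
    unfold blowExp
    split_ifs <;> omega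
  have hzero : monom x a • y = 0 := by
    -- On `A` the bound `u i < q` gives `a i ≥ 1`, so `a + coExp` contains `q` there and the
    -- subtraction is not truncated.
    set c : ι → ℕ := fun i => a i + coExp V₁ q i - q * if i ∈ A then 1 else 0 with hc
    have h1 : a + coExp V₁ q = c + fun i => q * if i ∈ A then 1 else 0 := by
      funext i
      simp only [hc, Pi.add_apply]
      refine (Nat.sub_add_cancel ?_).symm
      split_ifs with hi
      · rw [hA, Finset.mem_inter, hmemV'] at hi
        have h3 := hbc i
        have h4 := hle a ha i
        rw [show nilExp V₂ i = 2 by simp [nilExp, hi.2]] at h3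
        have h5 := hi.1
        simp only [hu] at h5
        omega
      · simp
    rw [hy, ← mul_smul, ← monom_add, h1, monom_add, mul_smul, ← hψ', ← mul_smul, ← monom_add]
    have h0 : (∏ i ∈ s, x i) • ψ η' = 0 := by rw [hx.prod_eq_zero s hs, zero_smul]
    -- Each `i ∈ s` must occur in the remaining exponent. For `i ∈ A` this is `a i ≥ 2`, for `i ∈ C`
    -- the added `q`, for `i ∈ V' ∩ V₁` it is `a i ≥ 1`; otherwise `coExp` gives `q - 1 ≥ 1`.
    refine smul_eq_zero_of_dvd ?_ h0
    rw [← monom_indicator]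
    apply monom_dvd
    intro i
    have h3 := hbc i
    have h4 := hle a ha i
    have h5 := hblow i
    have h6 := hblow' i
    have h7 := hmemV' i
    have h8 : i ∈ A ↔ i ∈ V' ∧ i ∈ V₂ := Finset.mem_inter
    have h9 : i ∈ C ↔ i ∉ V₂ ∧ i ∉ V' := by simp [hC]
    have h10 : nilExp V₂ i = if i ∈ V₂ then 2 else 1 := rfl
    have h11 : u i = blowExp V₁ V₂ q i - a i := rfl
    rw [h11] at h7
    simp only [hc, Pi.add_apply]
    rw [h10] at h3
    by_cases hi2 : i ∈ V₂ <;> by_cases hi' : i ∈ V' <;> by_cases his : i ∈ s <;>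
      simp only [h8, h9, hi2, hi', his, if_true, if_false, not_true, not_false_eq_true, and_true,
        and_false, true_iff, false_iff, mul_one, mul_zero, false_implies,
        true_implies] at h3 h5 h7 ⊢ <;> omega
  exact ha hzero

/-- The inner value, once multiplied by its test monomial, is killed by all variables, hence equals
`x c • ζ` with `ζ` in the same test set. Then `ψ` yields `x c ^ q`, while a single `x c` already
suffices to kill. -/
theorem comp_eq_zero [Module.Injective B E] (hx : IsFaceSystem 𝒜 x)
    (h12 : Disjoint V₁ V₂) (hV : IsCover 𝒜 V₂ᶜ) {c : ι} (hc : c ∈ V₂) {q q' : ℕ} (hq : 2 ≤ q)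
    (hq' : 2 ≤ q') (hcrit : IsCriticalExp 𝒜 V₁ V₂ q) (hcrit' : IsCriticalExp 𝒜 V₁ V₂ q')
    (ψ χ : E →+ E) (hψ : ∀ (r : B) (η : E), ψ (r • η) = r ^ q • ψ η)
    (hχ : ∀ (r : B) (η : E), χ (r • η) = r ^ q' • χ η) (η : E)
    (hη : ∀ i, x i ^ nilExp V₂ i • η = 0) :
    monom x (coExp V₁ (q * q')) • ψ (χ η) = 0 := by
  have hg := hx.smul_coExp_smul_eq_zero h12 hq' hcrit' χ hχ η hη
  obtain ⟨ζ, hζ, hζg⟩ := hx.exists_prod_smul_eq hV _ hg {c} (by simpa using hc)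
  rw [Finset.prod_singleton] at hζg
  have hζ' : ∀ i, x i ^ nilExp V₂ i • ζ = 0 := by
    intro i
    refine smul_eq_zero_of_dvd (pow_dvd_pow _ ?_) (hζ i)
    unfold nilExp
    split_ifs with h1 h2
    · exact le_rfl
    · exact absurd (Finset.mem_singleton.1 h1 ▸ hc) h2
    · omega
    · exact le_rfl
  rw [coExp_mul V₁ (by omega) (by omega), monom_add, monom_mul, mul_smul, ← hψ, ← hζg, hψ,
    smul_comm]
  obtain ⟨q, rfl⟩ := Nat.exists_eq_add_of_le' (show 1 ≤ q by omega)
  rw [pow_succ, mul_smul, hx.smul_coExp_smul_eq_zero h12 hq hcrit ψ hψ ζ hζ' c, smul_zero]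

end IsFaceSystem


/-! ### The Frobenius algebra is not finitely generated -/

/-- A `q⁻¹`-linear map. -/
def IsCartierMap {B : Type*} [CommRing B] (q : ℕ) (θ : B →+ B) : Prop :=
  ∀ r b, θ (r ^ q * b) = r * θ b

/-- The additive maps `B → E`, on which `B` acts by `(b • ρ) a = ρ (b a)`. -/
def DomainActionHom (B E : Type*) [CommRing B] [AddCommGroup E] : Type _ := B →+ E

namespace DomainActionHom

variable {B E : Type*} [CommRing B] [AddCommGroup E]

instance : AddCommGroup (DomainActionHom B E) := inferInstanceAs (AddCommGroup (B →+ E))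

instance : Module B (DomainActionHom B E) where
  smul b ρ := AddMonoidHom.comp (show B →+ E from ρ) (AddMonoidHom.mulLeft b)
  one_smul ρ := AddMonoidHom.ext fun a => by
    change (show B →+ E from ρ) (1 * a) = (show B →+ E from ρ) a
    rw [one_mul]
  mul_smul b c ρ := AddMonoidHom.ext fun a => by
    change (show B →+ E from ρ) (b * c * a) = (show B →+ E from ρ) (c * (b * a))
    rw [mul_left_comm, mul_assoc]
  smul_zero b := rfl
  smul_add b ρ ρ' := rfl
  add_smul b c ρ := AddMonoidHom.ext fun a => by
    change (show B →+ E from ρ) ((b + c) * a) =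
      (show B →+ E from ρ) (b * a) + (show B →+ E from ρ) (c * a)
    rw [add_mul, map_add]
  zero_smul ρ := AddMonoidHom.ext fun a => by
    change (show B →+ E from ρ) (0 * a) = 0
    rw [zero_mul, map_zero]

end DomainActionHom

/-- An injective module containing the residue field is a cogenerator. -/
theorem IsInjectiveHull.exists_linearMap_ne_zero.{u} {B E M : Type u} [CommRing B] [IsLocalRing B]
    [AddCommGroup E] [Module B E] [AddCommGroup M] [Module B M]
    {i : IsLocalRing.ResidueField B →ₗ[B] E} (hi : IsInjectiveHull i) (z : M) (hz : z ≠ 0) :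
    ∃ f : M →ₗ[B] E, f z ≠ 0 := by
  have := hi.injective_module
  let N := LinearMap.ker (LinearMap.toSpanSingleton B M z)
  have hN : N ≤ IsLocalRing.maximalIdeal B := by
    apply IsLocalRing.le_maximalIdeal
    rw [Ne, Ideal.eq_top_iff_one]
    simpa [N] using hz
  let f : (B ⧸ N) →ₗ[B] M := Submodule.liftQ N (LinearMap.toSpanSingleton B M z) le_rfl
  have hf : Function.Injective f := by
    rw [← LinearMap.ker_eq_bot]
    exact Submodule.ker_liftQ_eq_bot _ _ _ le_rfl
  let g : (B ⧸ N) →ₗ[B] E := i ∘ₗ Submodule.liftQ N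
    (Algebra.linearMap B (IsLocalRing.ResidueField B)) (fun b hb => by
      have : IsLocalRing.residue B b = 0 := (IsLocalRing.residue_eq_zero_iff b).2 (hN hb)
      exact this)
  obtain ⟨h, hh⟩ := Module.Injective.out (R := B) (Q := E) f hf g
  refine ⟨h, ?_⟩
  have h1 := hh (Submodule.Quotient.mk 1)
  have h2 : f (Submodule.Quotient.mk 1) = z := one_smul B z
  have h3 : g (Submodule.Quotient.mk 1) = i 1 := congrArg i (map_one (IsLocalRing.residue B))
  rw [h2, h3] at h1
  rw [h1, Ne, map_eq_zero_iff i hi.injective_map]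
  exact one_ne_zero

/-- The map `x ↦ (b ↦ θ b • x)` is `q`-semilinear into the additive maps `B → E` with `B` acting on
the source. Composing it with a linear map to `E` that does not vanish at `a • ev η` gives `φ`. -/
theorem IsInjectiveHull.exists_frobeniusMap.{u} {B E : Type u} [CommRing B] [IsLocalRing B]
    [AddCommGroup E] [Module B E] {i : IsLocalRing.ResidueField B →ₗ[B] E} (hi : IsInjectiveHull i)
    {q : ℕ} {θ : B →+ B} (hθ : IsCartierMap q θ) (a : B) (η : E) (hη : θ a • η ≠ 0) :
    ∃ φ : E →+ E, (∀ (r : B) (x : E), φ (r • x) = r ^ q • φ x) ∧ a • φ η ≠ 0 := by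
  let ev : E →+ DomainActionHom B E :=
    { toFun := fun x =>
        show B →+ E from
        { toFun := fun b => θ b • x
          map_zero' := by rw [map_zero, zero_smul]
          map_add' := fun b c => by rw [map_add, add_smul] }
      map_zero' := AddMonoidHom.ext fun b => smul_zero _
      map_add' := fun x y => AddMonoidHom.ext fun b => smul_add _ _ _ }
  have hev : ∀ (r : B) (x : E), ev (r • x) = r ^ q • ev x := by
    intro r x
    refine AddMonoidHom.ext fun b => ?_
    change θ b • r • x = θ (r ^ q * b) • x
    rw [hθ, mul_smul, smul_comm]
  obtain ⟨f, hf⟩ := hi.exists_linearMap_ne_zero (a • ev η) (fun h => hη (by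
    have h1 := DFunLike.congr_fun (show (show B →+ E from a • ev η) = 0 from h) (1 : B)
    change θ (a * 1) • η = 0 at h1
    rwa [mul_one] at h1))
  refine ⟨f.toAddMonoidHom.comp ev, fun r x => ?_, ?_⟩
  · change f (ev (r • x)) = r ^ q • f (ev x)
    rw [hev, map_smul]
  · change a • f (ev η) ≠ 0
    rwa [← map_smul]

/-- If, for every `e ≥ 1`, a product of homogeneous elements of positive degrees and total degree
`e` annihilates `H` after multiplication by `t e`, then in all large degrees every element of a
finitely generated Frobenius algebra does so. -/
theorem FrobeniusAlgebra.IsFinitelyGenerated.exists_degree {p : ℕ} {B E : Type*} [CommRing B]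
    [AddCommGroup E] [Module B E] (hfg : FrobeniusAlgebra.IsFinitelyGenerated p B E)
    (H : Set E) (hH : ∀ f : E →ₗ[B] E, ∀ η ∈ H, f η ∈ H) (t : ℕ → B)
    (ht : ∀ e e', 1 ≤ e → 1 ≤ e' → ∀ ψ ∈ frobeniusMaps p B E e, ∀ χ ∈ frobeniusMaps p B E e',
      ∀ η ∈ H, t (e + e') • ψ (χ η) = 0) :
    ∃ e, 1 ≤ e ∧ ∀ φ ∈ frobeniusMaps p B E e, ∀ η ∈ H, t e • φ η = 0 := by
  classical
  obtain ⟨T, hT⟩ := hfg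
  obtain ⟨e₀, he₀⟩ : ∃ e₀, ∀ a ∈ T, ∀ e ∈ DFinsupp.support a, e < e₀ := by
    refine ⟨(T.sup DFinsupp.support).sup id + 1, fun a ha e he => ?_⟩
    have : e ∈ T.sup DFinsupp.support := Finset.mem_sup.2 ⟨a, ha, he⟩
    exact Nat.lt_succ_of_le (Finset.le_sup (f := id) this)
  have hlin : ∀ (a : frobeniusMaps p B E 0) (r : B) (x : E),
      (a : E →+ E) (r • x) = r • (a : E →+ E) x := by
    intro a r x
    have := a.2 r x
    rwa [pow_zero, pow_one] at this
  -- In degree `e`, a product splits into terms of bidegree `(i, j)`. If `i = 0` the left factor is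
  -- linear and commutes with `t e`; if `j = 0` the right factor preserves `H`; otherwise `ht`
  -- applies.
  let S : Subring (FrobeniusAlgebra p B E) :=
    { carrier := {a | ∀ e, e₀ + 1 ≤ e → ∀ η ∈ H, t e • ((a e : AddMonoid.End E) : E →+ E) η = 0}
      zero_mem' := fun e _ η _ => smul_zero _
      one_mem' := by
        intro e he η _
        have : (1 : FrobeniusAlgebra p B E) e = 0 :=
          DirectSum.of_eq_of_ne _ _ _ (by omega)
        rw [this]
        exact smul_zero _
      add_mem' := by
        intro a b ha hb e he η hη
        change t e • (((a e : AddMonoid.End E) : E →+ E) η + ((b e : AddMonoid.End E) : E →+ E) η)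
          = 0
        rw [smul_add, ha e he η hη, hb e he η hη, add_zero]
      neg_mem' := by
        intro a ha e he η hη
        change t e • -(((a e : AddMonoid.End E) : E →+ E) η) = 0
        rw [smul_neg, ha e he η hη, neg_zero]
      mul_mem' := by
        intro a b ha hb e he η hη
        rw [DirectSum.coe_mul_apply_eq_sum_antidiagonal]
        have hsum : ((∑ ij ∈ Finset.HasAntidiagonal.antidiagonal e, (a ij.1 : AddMonoid.End E) * b ij.2 :
            AddMonoid.End E) : E →+ E) η = ∑ ij ∈ Finset.HasAntidiagonal.antidiagonal e,
              ((a ij.1 : AddMonoid.End E) : E →+ E) (((b ij.2 : AddMonoid.End E) : E →+ E) η) :=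
          AddMonoidHom.finsetSum_apply _ _ _
        rw [hsum, Finset.smul_sum]
        refine Finset.sum_eq_zero ?_
        rintro ⟨i, j⟩ hij
        rw [Finset.HasAntidiagonal.mem_antidiagonal] at hij
        simp only at hij ⊢
        rcases Nat.eq_zero_or_pos i with rfl | hi
        · obtain rfl : j = e := by omega
          have h := hlin (a 0) (t j) (((b j : AddMonoid.End E) : E →+ E) η)
          rw [hb _ he η hη] at h
          exact h.symm.trans (map_zero (a 0 : E →+ E))
        rcases Nat.eq_zero_or_pos j with rfl | hj
        · obtain rfl : i = e := by omega
          apply ha _ he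
          exact hH ⟨⟨(b 0 : E →+ E), map_add (b 0 : E →+ E)⟩, hlin (b 0)⟩ η hη
        · subst hij
          exact ht i j hi hj _ (a i).2 _ (b j).2 η hη }
  have hS : S = ⊤ := by
    rw [eq_top_iff, ← hT, Subring.closure_le]
    rintro a (⟨r, rfl⟩ | ha) e he η _
    · have : (FrobeniusAlgebra.scalar p B E r) e = 0 :=
        DirectSum.of_eq_of_ne _ _ _ (by omega)
      rw [this]
      exact smul_zero _
    · have : a e = 0 := by
        by_contra h
        have := he₀ a ha e (DFinsupp.mem_support_iff.2 h)
        omega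
      rw [this]
      exact smul_zero _
  refine ⟨e₀ + 1, by omega, fun φ hφ η hη => ?_⟩
  have : DirectSum.of (fun e => frobeniusMaps p B E e) (e₀ + 1) ⟨φ, hφ⟩ ∈ S := by
    rw [hS]
    trivial
  have h := this (e₀ + 1) le_rfl η hη
  rwa [DirectSum.of_eq_same] at h

/-- The abstract criterion: `comp_eq_zero` makes the test vanish on decomposable maps, while `θ` and
an `η` lying over the socle generator `i 1` produce a map in the same degree that passes it. -/
theorem IsFaceSystem.not_hasFGFrobeniusAlgebra.{u, v} {ι : Type v} [Fintype ι] [DecidableEq ι]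
    {B : Type u} [CommRing B] [IsLocalRing B] {𝒜 : Set (Finset ι)} {x : ι → B}
    (hx : IsFaceSystem 𝒜 x) (hxm : ∀ i, x i ∈ IsLocalRing.maximalIdeal B) {V₁ V₂ : Finset ι}
    (h12 : Disjoint V₁ V₂) (hV : IsCover 𝒜 V₂ᶜ) (hne : V₂.Nonempty) {p : ℕ} (hp : 2 ≤ p)
    (hcrit : ∀ e, 1 ≤ e → IsCriticalExp 𝒜 V₁ V₂ (p ^ e))
    (hθ : ∀ e, 1 ≤ e → ∃ θ : B →+ B, IsCartierMap (p ^ e) θ ∧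
      Associated (θ (monom x (coExp V₁ (p ^ e)))) (∏ i ∈ V₂, x i)) :
    ¬ HasFGFrobeniusAlgebra p B := by
  rintro ⟨E, _, _, i, hi, hfg⟩
  have := hi.injective_module
  obtain ⟨c, hc⟩ := hne
  have hpe : ∀ e, 1 ≤ e → 2 ≤ p ^ e := fun e he => hp.trans (Nat.le_self_pow (by omega) p)
  obtain ⟨e, he, hkill⟩ := hfg.exists_degree {η | ∀ i, x i ^ nilExp V₂ i • η = 0}
    (fun f η hη i => by rw [← map_smul, hη i, map_zero])
    (fun e => monom x (coExp V₁ (p ^ e)))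
    (fun e e' he he' ψ hψ χ hχ η hη => by
      rw [pow_add]
      exact hx.comp_eq_zero h12 hV hc (hpe e he) (hpe e' he') (hcrit e he) (hcrit e' he')
        ψ χ hψ hχ η hη)
  obtain ⟨η, hη, hg⟩ := hx.exists_prod_smul_eq hV (i 1)
    (fun j => by
      have : x j • (1 : IsLocalRing.ResidueField B) = 0 := by
        rw [Algebra.smul_def, mul_one]
        exact (IsLocalRing.residue_eq_zero_iff _).2 (hxm j)
      rw [← map_smul, this, map_zero]) V₂ subset_rfl
  obtain ⟨θ, hθ, hθx⟩ := hθ e he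
  obtain ⟨φ, hφ, hne⟩ := hi.exists_frobeniusMap hθ (monom x (coExp V₁ (p ^ e))) η (fun h0 => by
    have := smul_eq_zero_of_dvd hθx.dvd h0
    rw [hg, map_eq_zero_iff i hi.injective_map] at this
    exact one_ne_zero this)
  exact hne (hkill φ hφ η hη)


/-! ### Cartier maps -/

namespace IsCartierMap

variable {R : Type*} [CommRing R] {q : ℕ} {θ : R →+ R}

theorem comp_mulLeft (hθ : IsCartierMap q θ) (a : R) :
    IsCartierMap q (θ.comp (AddMonoidHom.mulLeft a)) := fun r b => by
  change θ (a * (r ^ q * b)) = r * θ (a * b)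
  rw [mul_left_comm, hθ]

theorem map_span_pow_le (hθ : IsCartierMap q θ) (I : Ideal R) {b : R}
    (hb : b ∈ Ideal.span ((fun a => a ^ q) '' (I : Set R))) : θ b ∈ I := by
  induction hb using Submodule.span_induction with
  | mem x hx =>
    obtain ⟨a, ha, rfl⟩ := hx
    have := hθ a 1
    rw [mul_one] at this
    change θ (a ^ q) ∈ I
    rw [this]
    exact I.mul_mem_right _ ha
  | zero => rw [map_zero]; exact I.zero_mem
  | add x y _ _ hx hy => rw [map_add]; exact I.add_mem hx hy
  | smul c x hx ih =>
    clear ih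
    -- `θ` is not linear, so `ih` does not help; a second induction carries an arbitrary coefficient
    -- `c`.
    rw [smul_eq_mul]
    induction hx using Submodule.span_induction generalizing c with
    | mem x hx =>
      obtain ⟨a, ha, rfl⟩ := hx
      change θ (c * a ^ q) ∈ I
      rw [mul_comm, hθ]
      exact I.mul_mem_right _ ha
    | zero => rw [mul_zero, map_zero]; exact I.zero_mem
    | add x y _ _ hx hy => rw [mul_add, map_add]; exact I.add_mem (hx c) (hy c)
    | smul d x _ ih => rw [smul_eq_mul, ← mul_assoc]; exact ih (c * d)

theorem exists_quotient (hθ : IsCartierMap q θ) (I : Ideal R) (hI : ∀ b ∈ I, θ b ∈ I) :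
    ∃ θ' : R ⧸ I →+ R ⧸ I, IsCartierMap q θ' ∧
      ∀ b, θ' (Ideal.Quotient.mk I b) = Ideal.Quotient.mk I (θ b) := by
  let θ' : R ⧸ I →+ R ⧸ I := QuotientAddGroup.map I.toAddSubgroup I.toAddSubgroup θ hI
  have h : ∀ b, θ' (Ideal.Quotient.mk I b) = Ideal.Quotient.mk I (θ b) := fun b => rfl
  refine ⟨θ', fun r b => ?_, h⟩
  obtain ⟨r, rfl⟩ := Ideal.Quotient.mk_surjective r
  obtain ⟨b, rfl⟩ := Ideal.Quotient.mk_surjective b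
  rw [← map_pow, ← map_mul, h, h, hθ, map_mul]

/-- Writing `a / t = t ^ (q - 1) * a / t ^ q` forces the value `θ (t ^ (q - 1) * a) / t` on a
fraction; this is its independence of the representative. -/
theorem mk'_eq_mk' (hθ : IsCartierMap q θ) (hq : 1 ≤ q) (M : Submonoid R) {S : Type*} [CommRing S]
    [Algebra R S] [IsLocalization M S] {a a' : R} {t t' : M}
    (h : IsLocalization.mk' S a t = IsLocalization.mk' S a' t') :
    IsLocalization.mk' S (θ (t ^ (q - 1) * a)) t =
      IsLocalization.mk' S (θ (t' ^ (q - 1) * a')) t' := by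
  obtain ⟨q, rfl⟩ := Nat.exists_eq_add_of_le' hq
  rw [Nat.add_sub_cancel]
  rw [IsLocalization.eq] at h ⊢
  obtain ⟨c, hc⟩ := h
  refine ⟨c, ?_⟩
  rw [← hθ, ← hθ, ← hθ, ← hθ]
  congr 1
  calc (c : R) ^ (q + 1) * ((t' : R) ^ (q + 1) * ((t : R) ^ q * a))
      = (c : R) ^ q * (t' : R) ^ q * (t : R) ^ q * (c * (t' * a)) := by ring
    _ = (c : R) ^ q * (t' : R) ^ q * (t : R) ^ q * (c * (t * a')) := by rw [hc]
    _ = _ := by ring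

theorem exists_localization (hθ : IsCartierMap q θ) (hq : 1 ≤ q) (M : Submonoid R) (S : Type*)
    [CommRing S] [Algebra R S] [IsLocalization M S] :
    ∃ θ' : S →+ S, IsCartierMap q θ' ∧ ∀ b, θ' (algebraMap R S b) = algebraMap R S (θ b) := by
  let f : S → S := fun z => IsLocalization.mk' S
    (θ ((IsLocalization.sec M z).2 ^ (q - 1) * (IsLocalization.sec M z).1)) (IsLocalization.sec M z).2
  have hf : ∀ (a : R) (t : M), f (IsLocalization.mk' S a t) =
      IsLocalization.mk' S (θ (t ^ (q - 1) * a)) t := fun a t =>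
    hθ.mk'_eq_mk' hq M (IsLocalization.mk'_sec S _)
  have hmk : ∀ (a b : R) (t : M), IsLocalization.mk' S (a + b) t =
      IsLocalization.mk' S a t + IsLocalization.mk' S b t := fun a b t => by
    rw [IsLocalization.mk'_eq_mul_mk'_one, map_add, add_mul, ← IsLocalization.mk'_eq_mul_mk'_one,
      ← IsLocalization.mk'_eq_mul_mk'_one]
  have hadd : ∀ z w, f (z + w) = f z + f w := by
    intro z w
    obtain ⟨a, b, t, ha, hb⟩ := IsLocalization.surj₂ M S z w
    rw [← IsLocalization.eq_mk'_iff_mul_eq] at ha hb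
    rw [ha, hb, ← hmk, hf, hf, hf, mul_add, map_add, hmk]
  refine ⟨AddMonoidHom.mk' f hadd, ?_, ?_⟩
  · intro z w
    change f (z ^ q * w) = z * f w
    obtain ⟨a, b, t, ha, hb⟩ := IsLocalization.surj₂ M S z w
    rw [← IsLocalization.eq_mk'_iff_mul_eq] at ha hb
    rw [ha, hb, hf, ← IsLocalization.mk'_pow, ← IsLocalization.mk'_mul, hf,
      ← IsLocalization.mk'_mul, IsLocalization.eq]
    refine ⟨1, ?_⟩
    obtain ⟨q, rfl⟩ := Nat.exists_eq_add_of_le' hq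
    simp only [OneMemClass.coe_one, one_mul, Submonoid.coe_mul, SubmonoidClass.coe_pow,
      Nat.add_sub_cancel]
    have h1 : ((t : R) ^ (q + 1) * t) ^ q * (a ^ (q + 1) * b) =
        ((t : R) ^ q * a) ^ (q + 1) * ((t : R) ^ q * b) := by ring
    rw [h1, hθ]
    ring
  · intro b
    change f _ = _
    rw [← IsLocalization.mk'_one (M := M) S b, hf, ← IsLocalization.mk'_one (M := M) S]
    simp

/-- `θ` is continuous: as `I` is finitely generated, a high power of `I ^ n` lies in the ideal
generated by the `q`-th powers of its elements, which `θ` maps into `I ^ n`. -/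
theorem exists_adicCompletion (hθ : IsCartierMap q θ) (I : Ideal R) (hI : I.FG) :
    ∃ θ' : AdicCompletion I R →+ AdicCompletion I R, IsCartierMap q θ' ∧
      ∀ b, θ' (algebraMap R _ b) = algebraMap R _ (θ b) := by
  have hex : ∀ n, ∃ N, ∀ b ∈ I ^ N, θ b ∈ I ^ n := by
    intro n
    obtain ⟨l, hl⟩ := Ideal.exists_pow_le_of_le_radical_of_fg
      (I := I ^ n) (J := Ideal.span ((fun a => a ^ q) '' ((I ^ n : Ideal R) : Set R)))
      (fun a ha => ⟨q, Ideal.subset_span ⟨a, ha, rfl⟩⟩) hI.pow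
    rw [← pow_mul] at hl
    exact ⟨n * l, fun b hb => hθ.map_span_pow_le _ (hl hb)⟩
  choose N₀ hN₀ using hex
  -- Making the modulus monotone gives compatibility of the levels; `n ≤ N n` lets one
  -- representative serve at both levels.
  let N : ℕ → ℕ := fun n => n + ∑ i ∈ Finset.range (n + 1), N₀ i
  have hNn : ∀ n, n ≤ N n := fun n => Nat.le_add_right _ _
  have hmono : Monotone N := fun m n h => Nat.add_le_add h
    (Finset.sum_le_sum_of_subset (Finset.range_mono (by omega)))
  have hN : ∀ n, ∀ b ∈ I ^ N n, θ b ∈ I ^ n := by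
    intro n b hb
    refine hN₀ n b (Ideal.pow_le_pow_right ?_ hb)
    have := Finset.single_le_sum (f := N₀) (fun _ _ => Nat.zero_le _)
      (Finset.self_mem_range_succ n)
    exact this.trans (Nat.le_add_left _ _)
  have htop : ∀ n, (I ^ n • ⊤ : Ideal R) = I ^ n := fun n => by simp
  let ev : ∀ n, R → R ⧸ (I ^ n • ⊤ : Ideal R) := fun n => Submodule.Quotient.mk
  have hwd : ∀ n a b, ev (N n) a = ev (N n) b → ev n (θ a) = ev n (θ b) := by
    intro n a b h
    refine (Submodule.Quotient.eq _).2 ?_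
    rw [← map_sub, htop]
    refine hN n _ ?_
    rw [← htop]
    exact (Submodule.Quotient.eq _).1 h
  let f : ∀ x : AdicCompletion I R, ∀ n, R ⧸ (I ^ n • ⊤ : Ideal R) := fun x n =>
    ev n (θ (Function.surjInv (Submodule.Quotient.mk_surjective _) (x.val (N n))))
  have hf : ∀ (x : AdicCompletion I R) n a, x.val (N n) = ev (N n) a → f x n = ev n (θ a) :=
    fun x n a h => hwd n _ _ ((Function.surjInv_eq _ _).trans h)
  have hrep : ∀ (x : AdicCompletion I R) n, ∃ a, ∀ m ≤ n, x.val m = ev m a := by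
    intro x n
    obtain ⟨a, ha⟩ := Submodule.Quotient.mk_surjective _ (x.val n)
    refine ⟨a, fun m hm => ?_⟩
    have := x.property hm
    rw [← this, ← ha]
    rfl
  let F : AdicCompletion I R → AdicCompletion I R := fun x => ⟨f x, fun {m n} hmn => by
    obtain ⟨a, ha⟩ := hrep x (N n)
    rw [hf x n a (ha _ le_rfl), hf x m a (ha _ (hmono hmn))]
    rfl⟩
  have hF : ∀ x n, (F x).val n = f x n := fun x n => rfl
  refine ⟨AddMonoidHom.mk' F fun x y => ?_, fun x y => ?_, fun b => ?_⟩
  · apply AdicCompletion.ext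
    intro n
    obtain ⟨a, ha⟩ := hrep x (N n)
    obtain ⟨b, hb⟩ := hrep y (N n)
    rw [AdicCompletion.val_add_apply, hF, hF, hF, hf x n a (ha _ le_rfl), hf y n b (hb _ le_rfl),
      hf (x + y) n (a + b) (by rw [AdicCompletion.val_add_apply, ha _ le_rfl, hb _ le_rfl]; rfl),
      map_add]
    rfl
  · change F (x ^ q * y) = x * F y
    apply AdicCompletion.ext
    intro n
    obtain ⟨a, ha⟩ := hrep x (N n)
    obtain ⟨b, hb⟩ := hrep y (N n)
    have hpow : (x ^ q).val (N n) = x.val (N n) ^ q := rfl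
    rw [AdicCompletion.val_mul, hF, hF, hf y n b (hb _ le_rfl), ha n (hNn n),
      hf _ n (a ^ q * b) (by
        rw [AdicCompletion.val_mul, hpow, ha _ le_rfl, hb _ le_rfl]; rfl), hθ]
    rfl
  · change F _ = _
    apply AdicCompletion.ext
    intro n
    rw [hF, hf _ n b rfl]
    rfl

end IsCartierMap

/-! ### Cartier maps on power series -/

/-- A linear retraction of the field extension; for a Frobenius it replaces the `q`-th root, so `k`
need not be perfect. -/
theorem RingHom.exists_addMonoidHom_map_mul {K L : Type*} [Field K] [Field L] (F : K →+* L) :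
    ∃ θ : L →+ K, (∀ c s, θ (F c * s) = c * θ s) ∧ θ 1 = 1 := by
  let _ : Algebra K L := F.toAlgebra
  obtain ⟨g, hg⟩ := (Algebra.linearMap K L).exists_leftInverse_of_injective
    (LinearMap.ker_eq_bot.2 F.injective)
  refine ⟨g.toAddMonoidHom, fun c s => g.map_smul c s, ?_⟩
  have := LinearMap.congr_fun hg (1 : K)
  simpa using this

/-- The map extracts the coefficients at exponents `p ^ e • m + ρ` and applies a retraction of
Frobenius to them. Since `r ^ p ^ e` only has exponents divisible by `p ^ e`, the convolution sums
agree. -/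
theorem MvPowerSeries.exists_isCartierMap {ι k : Type*} [Field k] (p : ℕ) [Fact p.Prime] [CharP k p]
    (e : ℕ) (ρ : ι →₀ ℕ) (hρ : ∀ i, ρ i < p ^ e) :
    ∃ θ : MvPowerSeries ι k →+ MvPowerSeries ι k, IsCartierMap (p ^ e) θ ∧
      ∀ m, θ (MvPowerSeries.monomial (p ^ e • m + ρ) 1) = MvPowerSeries.monomial m 1 := by
  classical
  obtain ⟨θ, hθ, hθ1⟩ := (iterateFrobenius k p e).exists_addMonoidHom_map_mul
  simp only [iterateFrobenius_def] at hθ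
  have hp0 : p ≠ 0 := (Fact.out : p.Prime).ne_zero
  have hq0 : p ^ e ≠ 0 := pow_ne_zero _ hp0
  let f : MvPowerSeries ι k →+ MvPowerSeries ι k :=
    { toFun := fun a m => θ (MvPowerSeries.coeff (p ^ e • m + ρ) a)
      map_zero' := by
        funext m
        rw [map_zero, map_zero]
        rfl
      map_add' := fun a b => by
        funext m
        rw [map_add, map_add]
        rfl }
  have hf : ∀ a m, MvPowerSeries.coeff m (f a) = θ (MvPowerSeries.coeff (p ^ e • m + ρ) a) :=
    fun a m => rfl
  refine ⟨f, fun r b => ?_, fun m => ?_⟩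
  · ext m
    have hr : ∀ a, MvPowerSeries.coeff (p ^ e • a) (r ^ p ^ e) = MvPowerSeries.coeff a r ^ p ^ e := by
      intro a
      rw [← MvPowerSeries.map_iterateFrobenius_expand p hp0, MvPowerSeries.coeff_map,
        MvPowerSeries.coeff_expand_smul, iterateFrobenius_def]
    have hr0 : ∀ a i, ¬ p ^ e ∣ a i → MvPowerSeries.coeff a (r ^ p ^ e) = 0 := by
      intro a i hi
      rw [← MvPowerSeries.map_iterateFrobenius_expand p hp0, MvPowerSeries.coeff_map,
        MvPowerSeries.coeff_expand_of_not_dvd _ _ _ hi, map_zero]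
    rw [hf, MvPowerSeries.coeff_mul, MvPowerSeries.coeff_mul]
    have hsum : ∑ ab ∈ Finset.HasAntidiagonal.antidiagonal m, MvPowerSeries.coeff ab.1 r ^ p ^ e *
          MvPowerSeries.coeff (p ^ e • ab.2 + ρ) b =
        ∑ ab ∈ Finset.HasAntidiagonal.antidiagonal (p ^ e • m + ρ),
          MvPowerSeries.coeff ab.1 (r ^ p ^ e) * MvPowerSeries.coeff ab.2 b := by
      refine Finset.sum_of_injOn (fun ab => (p ^ e • ab.1, p ^ e • ab.2 + ρ)) ?_ ?_ ?_ ?_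
      · rintro ⟨a, a'⟩ - ⟨c, c'⟩ - h
        simpa [hp0] using h
      · rintro ⟨a, a'⟩ h
        simp only [Finset.mem_coe, Finset.HasAntidiagonal.mem_antidiagonal] at h ⊢
        rw [← h, smul_add, add_assoc]
      · rintro ⟨a, a'⟩ h hnot
        rw [Finset.HasAntidiagonal.mem_antidiagonal] at h
        simp only at h ⊢
        by_cases hdvd : ∀ i, p ^ e ∣ a i
        · exfalso
          choose c hc using hdvd
          -- Here `ρ i < p ^ e` is decisive: a multiple of `p ^ e` below `p ^ e * m i + ρ i` is at
          -- most `p ^ e * m i`.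
          have hcm : ∀ i, c i ≤ m i := by
            intro i
            have h1 := DFunLike.congr_fun h i
            have h2 := hρ i
            simp only [Finsupp.add_apply, Finsupp.smul_apply, smul_eq_mul, hc] at h1
            have : p ^ e * c i < p ^ e * (m i + 1) := by rw [mul_add]; omega
            exact Nat.lt_succ_iff.1 (lt_of_mul_lt_mul_left this (Nat.zero_le _))
          let c' : ι →₀ ℕ := Finsupp.onFinset m.support c (fun i hi => by
            rw [Finsupp.mem_support_iff]
            have := hcm i
            omega)
          have hc' : a = p ^ e • c' := by
            ext i
            simp [c', hc]
          apply hnot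
          refine ⟨(c', m - c'), ?_, ?_⟩
          · simp only [Finset.mem_coe, Finset.HasAntidiagonal.mem_antidiagonal]
            exact add_tsub_cancel_of_le (fun i => hcm i)
          · simp only [Prod.mk.injEq]
            refine ⟨hc'.symm, ?_⟩
            have hm : m = c' + (m - c') := (add_tsub_cancel_of_le (fun i => hcm i)).symm
            rw [hc', hm, smul_add, add_assoc] at h
            exact (add_left_cancel h).symm
        · push Not at hdvd
          obtain ⟨i, hi⟩ := hdvd
          rw [hr0 a i hi, zero_mul]
      · rintro ⟨a, a'⟩ -
        simp only [hr]
    rw [← hsum, map_sum]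
    exact Finset.sum_congr rfl fun ab _ => by rw [hθ, hf]
  · ext m'
    rw [hf, MvPowerSeries.coeff_monomial, MvPowerSeries.coeff_monomial]
    by_cases h : m' = m
    · simp [h, hθ1]
    · have : ¬ (p ^ e • m' + ρ = p ^ e • m + ρ) := fun h' => h (by simpa [hp0] using h')
      rw [if_neg h, if_neg this, map_zero]


/-! ### Regular elements modulo an ideal under flat base change -/

/-- Tensoring with a flat algebra preserves injectivity of multiplication by `a` on `S ⧸ 𝔟`. -/
theorem Ideal.mem_map_of_mul_mem_map_of_flat {S B : Type*} [CommRing S] [CommRing B] [Algebra S B]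
    [Module.Flat S B] (𝔟 : Ideal S) (a : S) (ha : ∀ r, a * r ∈ 𝔟 → r ∈ 𝔟) (r : B)
    (hr : algebraMap S B a * r ∈ 𝔟.map (algebraMap S B)) : r ∈ 𝔟.map (algebraMap S B) := by
  let f : (S ⧸ 𝔟) →ₗ[S] (S ⧸ 𝔟) := LinearMap.lsmul S (S ⧸ 𝔟) a
  have hf : Function.Injective f := by
    rw [injective_iff_map_eq_zero]
    intro z hz
    obtain ⟨r, rfl⟩ := Ideal.Quotient.mk_surjective z
    exact Ideal.Quotient.eq_zero_iff_mem.2 (ha r (Ideal.Quotient.eq_zero_iff_mem.1 hz))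
  have hmem : ∀ b : B, b ∈ 𝔟.map (algebraMap S B) ↔
      TensorProduct.tmul S (1 : S ⧸ 𝔟) b = 0 := by
    intro b
    rw [← (TensorProduct.quotTensorEquivQuotSMul B 𝔟).map_eq_zero_iff]
    have : TensorProduct.quotTensorEquivQuotSMul B 𝔟 (TensorProduct.tmul S (1 : S ⧸ 𝔟) b) =
        Submodule.Quotient.mk b := by
      have := TensorProduct.quotTensorEquivQuotSMul_mk_tmul (M := B) (I := 𝔟) 1 b
      rwa [map_one, one_smul] at this
    rw [this, Submodule.Quotient.mk_eq_zero, Ideal.smul_top_eq_map]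
    rfl
  rw [hmem] at hr ⊢
  have hinj := Module.Flat.rTensor_preserves_injective_linearMap (M := B) f hf
  apply hinj
  rw [map_zero, LinearMap.rTensor_tmul, ← hr]
  change TensorProduct.tmul S (a • (1 : S ⧸ 𝔟)) r = _
  rw [TensorProduct.smul_tmul, Algebra.smul_def]

/-! ### Completed local rings -/

namespace CompletedLocalRing

variable {A : Type*} [CommRing A] (P : PrimeSpectrum A)

theorem isUnit_algebraMap {a : A} (ha : a ∉ P.asIdeal) :
    IsUnit (algebraMap A (CompletedLocalRing P) a) := by
  rw [IsScalarTower.algebraMap_apply A (Localization.AtPrime P.asIdeal)]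
  exact (IsLocalization.map_units (Localization.AtPrime P.asIdeal)
    (⟨a, ha⟩ : P.asIdeal.primeCompl)).map _

theorem algebraMap_mem_maximalIdeal [IsNoetherianRing A] {a : A} (ha : a ∈ P.asIdeal) :
    algebraMap A (CompletedLocalRing P) a ∈ IsLocalRing.maximalIdeal (CompletedLocalRing P) := by
  rw [IsScalarTower.algebraMap_apply A (Localization.AtPrime P.asIdeal),
    AdicCompletion.maximalIdeal_eq_map]
  refine Ideal.mem_map_of_mem _ ?_
  exact (IsLocalization.AtPrime.to_map_mem_maximal_iff _ P.asIdeal a).2 ha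

instance [IsNoetherianRing A] : Module.Flat A (CompletedLocalRing P) :=
  Module.Flat.trans A (Localization.AtPrime P.asIdeal) _

/-- An element of the extension of `I` to the completed local ring at `P` lies in `I + P ^ K`, up to
a factor outside `P`. -/
theorem exists_mul_mem_of_algebraMap_mem (I : Ideal A) (a : A)
    (ha : algebraMap A (CompletedLocalRing P) a ∈ I.map (algebraMap A (CompletedLocalRing P)))
    (K : ℕ) : ∃ s, s ∉ P.asIdeal ∧ s * a ∈ I ⊔ P.asIdeal ^ K := by
  let L := Localization.AtPrime P.asIdeal
  let ev : CompletedLocalRing P →+* L ⧸ IsLocalRing.maximalIdeal L ^ K :=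
    (AdicCompletion.evalₐ (IsLocalRing.maximalIdeal L) K : _ →+* _)
  have hev : ev.comp (algebraMap A (CompletedLocalRing P)) =
      (Ideal.Quotient.mk (IsLocalRing.maximalIdeal L ^ K)).comp (algebraMap A L) := by
    ext b
    exact AdicCompletion.evalₐ_of _ K _
  have h1 := Ideal.mem_map_of_mem ev ha
  rw [Ideal.map_map, ← RingHom.comp_apply, hev, ← Ideal.map_map, RingHom.comp_apply,
    ← Ideal.mem_comap, Ideal.comap_map_of_surjective _ Ideal.Quotient.mk_surjective,
    ← RingHom.ker_eq_comap_bot, Ideal.mk_ker, ← IsLocalization.AtPrime.map_eq_maximalIdeal P.asIdeal L,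
    ← Ideal.map_pow, ← Ideal.map_sup] at h1
  obtain ⟨s, hs, h⟩ := (IsLocalization.algebraMap_mem_map_algebraMap_iff P.asIdeal.primeCompl L _ a).1 h1
  exact ⟨s, hs, h⟩

/-- A Cartier map on a Noetherian ring extends to its completed local rings. -/
theorem exists_isCartierMap [IsNoetherianRing A] {q : ℕ} (hq : 1 ≤ q) {θ : A →+ A}
    (hθ : IsCartierMap q θ) : ∃ θ' : CompletedLocalRing P →+ CompletedLocalRing P,
      IsCartierMap q θ' ∧ ∀ b, θ' (algebraMap A _ b) = algebraMap A _ (θ b) := by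
  obtain ⟨θ₁, hθ₁, h₁⟩ := hθ.exists_localization hq P.asIdeal.primeCompl
    (Localization.AtPrime P.asIdeal)
  obtain ⟨θ₂, hθ₂, h₂⟩ := hθ₁.exists_adicCompletion
    (IsLocalRing.maximalIdeal (Localization.AtPrime P.asIdeal))
    (IsNoetherian.noetherian _)
  refine ⟨θ₂, hθ₂, fun b => ?_⟩
  rw [IsScalarTower.algebraMap_apply A (Localization.AtPrime P.asIdeal), h₂, h₁,
    ← IsScalarTower.algebraMap_apply]

end CompletedLocalRing

/-! ### Monomial ideals of power series rings -/

namespace MvPowerSeries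

section

variable {ι k : Type*} [CommRing k]

/-- The power series all of whose exponents belong to an upper set. -/
def supportedIdeal (k : Type*) [CommRing k] (U : Set (ι →₀ ℕ)) (hU : IsUpperSet U) :
    Ideal (MvPowerSeries ι k) where
  carrier := {f | ∀ c, coeff c f ≠ 0 → c ∈ U}
  zero_mem' c h := absurd (map_zero _) h
  add_mem' {f g} hf hg c h := by
    by_cases hfc : coeff c f = 0
    · refine hg c fun hgc => h ?_
      rw [map_add, hfc, hgc, add_zero]
    · exact hf c hfc
  smul_mem' f g hg c h := by
    classical
    rw [smul_eq_mul, coeff_mul] at h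
    obtain ⟨⟨a, b⟩, hab, hne⟩ := Finset.exists_ne_zero_of_sum_ne_zero h
    rw [Finset.HasAntidiagonal.mem_antidiagonal] at hab
    simp only at hab hne
    exact hU (hab ▸ le_add_self) (hg b (right_ne_zero_of_mul hne))

theorem monomial_mem_supportedIdeal {U : Set (ι →₀ ℕ)} (hU : IsUpperSet U) {m : ι →₀ ℕ}
    (hm : m ∈ U) (r : k) : monomial m r ∈ supportedIdeal k U hU := by
  classical
  intro c hc
  rw [coeff_monomial] at hc
  by_cases h : c = m
  · exact h ▸ hm
  · rw [if_neg h] at hc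
    exact absurd rfl hc

theorem mem_span_X_pow (s : Finset ι) (a : ι → ℕ) (f : MvPowerSeries ι k)
    (hf : ∀ m : ι →₀ ℕ, (∀ j ∈ s, m j < a j) → coeff m f = 0) :
    f ∈ Ideal.span ((fun j => (X j : MvPowerSeries ι k) ^ a j) '' s) := by
  classical
  induction s using Finset.induction_on generalizing f with
  | empty =>
    have : f = 0 := by
      ext m
      simpa using hf m (by simp)
    simp [this]
  | insert b s hb ih =>
    let f₂ : MvPowerSeries ι k := fun m => if m b < a b then coeff m f else 0
    have hf₂ : ∀ m, coeff m f₂ = if m b < a b then coeff m f else 0 := fun m => rfl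
    have h1 : (X b : MvPowerSeries ι k) ^ a b ∣ f - f₂ := by
      rw [X_pow_dvd_iff]
      intro m hm
      simp [hf₂, hm]
    have h2 : f₂ ∈ Ideal.span ((fun j => (X j : MvPowerSeries ι k) ^ a j) '' s) := by
      apply ih
      intro m hm
      rw [hf₂]
      split_ifs with h0
      · exact hf m (by simpa [h0] using hm)
      · rfl
    rw [← sub_add_cancel f f₂]
    refine Ideal.add_mem _ ?_ (Ideal.span_mono (Set.image_mono (by simp)) h2)
    exact Ideal.mem_of_dvd _ h1 (Ideal.subset_span ⟨b, by simp, rfl⟩)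

theorem mem_span_X_pow_of_X_mul_mem (s : Finset ι) (a : ι → ℕ) (j : ι) (hj : j ∉ s)
    (f : MvPowerSeries ι k)
    (hf : X j * f ∈ Ideal.span ((fun i => (X i : MvPowerSeries ι k) ^ a i) '' s)) :
    f ∈ Ideal.span ((fun i => (X i : MvPowerSeries ι k) ^ a i) '' s) := by
  classical
  have hU : IsUpperSet {c : ι →₀ ℕ | ∃ i ∈ s, a i ≤ c i} :=
    fun c c' hcc' ⟨i, hi, hc⟩ => ⟨i, hi, hc.trans (hcc' i)⟩
  have hle : Ideal.span ((fun i => (X i : MvPowerSeries ι k) ^ a i) '' s) ≤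
      supportedIdeal k _ hU := by
    rw [Ideal.span_le]
    rintro _ ⟨i, hi, rfl⟩
    simp only [X_pow_eq]
    exact monomial_mem_supportedIdeal hU ⟨i, hi, by simp⟩ 1
  refine mem_span_X_pow s a f fun m hm => ?_
  by_contra hne
  obtain ⟨i, hi, hc⟩ := hle hf (Finsupp.single j 1 + m) (by
    rwa [X, coeff_add_monomial_mul, one_mul])
  have hij : j ≠ i := fun h => hj (h ▸ hi)
  have := hm i hi
  simp [hij] at hc
  omega

end

end MvPowerSeries


/-! ### Monomial ideals of polynomial rings -/

section MonomialIdeals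

variable {n : ℕ} {k : Type*} [Field k]

theorem xPow_eq_monomial (a : Fin n → ℕ) :
    xPow k a = MvPolynomial.monomial (Finsupp.equivFunOnFinite.symm a) 1 := by
  rw [MvPolynomial.monomial_eq, Finsupp.prod_fintype _ _ (by simp)]
  simp [xPow]

theorem xPow_add (a b : Fin n → ℕ) : xPow k (a + b) = xPow k a * xPow k b := by
  simp [xPow, pow_add, Finset.prod_mul_distrib]

theorem xPow_pow (a : Fin n → ℕ) (q : ℕ) : xPow k a ^ q = xPow k fun i => q * a i := by
  simp only [xPow, ← Finset.prod_pow]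
  exact Finset.prod_congr rfl fun i _ => by rw [mul_comm, pow_mul]

theorem xPow_mem_span_iff (S : Set (Fin n → ℕ)) (a : Fin n → ℕ) :
    xPow k a ∈ Ideal.span (xPow k '' S) ↔ ∃ b ∈ S, ∀ i, b i ≤ a i := by
  have : xPow k '' S = (fun s => MvPolynomial.monomial s (1 : k)) ''
      (Finsupp.equivFunOnFinite.symm '' S) := by
    rw [Set.image_image]
    exact Set.image_congr fun b _ => xPow_eq_monomial b
  rw [this, MvPolynomial.mem_ideal_span_monomial_image, xPow_eq_monomial]
  classical
  rw [MvPolynomial.support_monomial, if_neg one_ne_zero]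
  constructor
  · intro h
    obtain ⟨_, ⟨b, hb, rfl⟩, hba⟩ := h _ (Finset.mem_singleton_self _)
    exact ⟨b, hb, hba⟩
  · rintro ⟨b, hb, hba⟩ e he
    rw [Finset.mem_singleton.1 he]
    exact ⟨_, ⟨b, hb, rfl⟩, hba⟩

/-- The exponent of the square-free monomial `∏ i ∈ s, x i`. -/
def faceExp (s : Finset (Fin n)) (i : Fin n) : ℕ := if i ∈ s then 1 else 0

theorem xPow_faceExp (s : Finset (Fin n)) : xPow k (faceExp s) = ∏ i ∈ s, MvPolynomial.X i := by
  simp [xPow, faceExp, Finset.prod_ite_mem, pow_ite]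

theorem frobeniusPower_span {A : Type*} [CommRing A] (p : ℕ) [Fact p.Prime] [CharP A p]
    (S : Set A) : frobeniusPower (Ideal.span S) p = Ideal.span ((fun a => a ^ p) '' S) := by
  apply le_antisymm
  · rw [frobeniusPower, Ideal.span_le]
    rintro _ ⟨a, ha, rfl⟩
    have := Ideal.mem_map_of_mem (frobenius A p) ha
    rwa [Ideal.map_span] at this
  · exact Ideal.span_mono (Set.image_mono Ideal.subset_span)

variable (p : ℕ) [Fact p.Prime] [CharP k p] (𝒜 : Set (Finset (Fin n)))
  (I : Ideal (MvPolynomial (Fin n) k))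
  (hI : I = Ideal.span ((fun s : Finset (Fin n) => ∏ i ∈ s, MvPolynomial.X i) '' 𝒜))

include hI

theorem frobeniusPower_faceIdeal_eq :
    frobeniusPower I p = Ideal.span (xPow k '' ((fun s i => p * faceExp s i) '' 𝒜)) := by
  rw [hI, frobeniusPower_span, Set.image_image, Set.image_image]
  congr 1
  exact Set.image_congr fun s _ => by rw [← xPow_faceExp, xPow_pow]

theorem xPow_mem_frobeniusPower_iff (a : Fin n → ℕ) :
    xPow k a ∈ frobeniusPower I p ↔ ∃ s ∈ 𝒜, ∀ i, p * faceExp s i ≤ a i := by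
  rw [frobeniusPower_faceIdeal_eq p 𝒜 I hI, xPow_mem_span_iff]
  simp

theorem xPow_mem_colon_iff (a : Fin n → ℕ) :
    xPow k a ∈ (frobeniusPower I p).colon (I : Set (MvPolynomial (Fin n) k)) ↔
      ∀ s ∈ 𝒜, ∃ s' ∈ 𝒜, ∀ i, p * faceExp s' i ≤ a i + faceExp s i := by
  rw [Submodule.mem_colon]
  constructor
  · intro h s hs
    have h1 : xPow k (faceExp s) ∈ I := by
      rw [hI, xPow_faceExp]
      exact Ideal.subset_span ⟨s, hs, rfl⟩
    have h2 := h _ h1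
    rw [smul_eq_mul, ← xPow_add, xPow_mem_frobeniusPower_iff p 𝒜 I hI] at h2
    exact h2
  · intro h f hf
    have hle : I ≤ Submodule.comap (LinearMap.mulLeft (MvPolynomial (Fin n) k)
        (xPow k a)) (frobeniusPower I p) := by
      conv_lhs => rw [hI]
      rw [Ideal.span_le]
      rintro _ ⟨s, hs, rfl⟩
      change xPow k a * ∏ i ∈ s, MvPolynomial.X i ∈ frobeniusPower I p
      rw [← xPow_faceExp, ← xPow_add, xPow_mem_frobeniusPower_iff p 𝒜 I hI]
      exact h s hs
    exact hle hf

theorem xPow_mem_sup_iff (β : Fin n → Fin 2) {r : ℕ} (m : Fin r → Fin n → ℕ)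
    (a : Fin n → ℕ) :
    xPow k a ∈ frobeniusPower I p ⊔ Ideal.span (Set.range fun μ => xPow k (m μ)) ⊔
      Ideal.span {xPow k (fun i => (β i : ℕ)) ^ (p - 1)} ↔
    xPow k a ∈ frobeniusPower I p ∨ (∃ μ, ∀ i, m μ i ≤ a i) ∨
      ∀ i, (p - 1) * (β i : ℕ) ≤ a i := by
  have h1 : (Set.range fun μ => xPow k (m μ)) = xPow k '' Set.range m := by
    rw [← Set.range_comp]
    rfl
  have h2 : ({xPow k (fun i => (β i : ℕ)) ^ (p - 1)} : Set (MvPolynomial (Fin n) k)) =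
      xPow k '' {fun i => (p - 1) * (β i : ℕ)} := by
    rw [Set.image_singleton, xPow_pow]
  rw [xPow_mem_frobeniusPower_iff p 𝒜 I hI, frobeniusPower_faceIdeal_eq p 𝒜 I hI, h1, h2,
    ← Ideal.span_union, ← Ideal.span_union, ← Set.image_union, ← Set.image_union,
    xPow_mem_span_iff]
  constructor
  · rintro ⟨b, (⟨s, hs, rfl⟩ | ⟨μ, rfl⟩) | rfl, hb⟩
    · exact Or.inl ⟨s, hs, hb⟩
    · exact Or.inr (Or.inl ⟨μ, hb⟩)
    · exact Or.inr (Or.inr hb)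
  · rintro (⟨s, hs, hb⟩ | ⟨μ, hb⟩ | hb)
    · exact ⟨_, Or.inl (Or.inl ⟨s, hs, rfl⟩), hb⟩
    · exact ⟨_, Or.inl (Or.inr ⟨μ, rfl⟩), hb⟩
    · exact ⟨_, Or.inr rfl, hb⟩

end MonomialIdeals

/-! ### Monomials in the completed local ring at a coordinate prime -/

section CoordPrime

variable {n : ℕ} {k : Type*} [Field k] (d : Fin n → Fin 2)

theorem MvPowerSeries.X_mem_span_varsOffSupport_iff (i : Fin n) :
    (MvPowerSeries.X i : MvPowerSeries (Fin n) k) ∈ Ideal.span (varsOffSupport k d) ↔ d i = 0 := by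
  constructor
  · intro h
    by_contra hi
    have hU : IsUpperSet {c : Fin n →₀ ℕ | ∃ j, d j = 0 ∧ 1 ≤ c j} :=
      fun c c' hcc' ⟨j, hj, hc⟩ => ⟨j, hj, hc.trans (hcc' j)⟩
    have hle : Ideal.span (varsOffSupport k d) ≤ MvPowerSeries.supportedIdeal k _ hU := by
      rw [Ideal.span_le]
      rintro _ ⟨j, hj, rfl⟩
      exact MvPowerSeries.monomial_mem_supportedIdeal hU ⟨j, hj, by simp⟩ 1
    obtain ⟨j, hj, hc⟩ := hle h (Finsupp.single i 1) (by simp)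
    have : i ≠ j := fun h => hi (h ▸ hj)
    simp [this] at hc
  · intro hi
    exact Ideal.subset_span ⟨i, hi, rfl⟩

theorem toCompletedLocalRing_X (i : Fin n) : toCompletedLocalRing k d (MvPolynomial.X i) =
    algebraMap (MvPowerSeries (Fin n) k) _ (MvPowerSeries.X i) := by
  simp [toCompletedLocalRing]

theorem toCompletedLocalRing_xPow_dvd {a b : Fin n → ℕ} (h : ∀ i, d i = 0 → a i ≤ b i) :
    toCompletedLocalRing k d (xPow k a) ∣ toCompletedLocalRing k d (xPow k b) := by
  simp only [xPow, map_prod, map_pow]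
  refine Finset.prod_dvd_prod_of_dvd _ _ fun i _ => ?_
  by_cases hi : d i = 0
  · exact pow_dvd_pow _ (h i hi)
  · refine ((CompletedLocalRing.isUnit_algebraMap (coordPrime k d) ?_).pow _).dvd
    exact fun hmem => hi ((MvPowerSeries.X_mem_span_varsOffSupport_iff (k := k) d i).1
      (by simpa [coordPrime] using hmem))

/-- A monomial in the extension of a monomial ideal to the completed local ring at `Q_{d⁺}` is
divisible, up to units, by a generator. -/
theorem exists_le_of_toCompletedLocalRing_xPow_mem {r : ℕ} (m : Fin r → Fin n → ℕ)
    (σ : Fin n → ℕ)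
    (h : toCompletedLocalRing k d (xPow k σ) ∈
      (Ideal.span (Set.range fun μ => xPow k (m μ))).map (toCompletedLocalRing k d)) :
    ∃ μ, ∀ i, d i = 0 → m μ i ≤ σ i := by
  classical
  let c := (MvPolynomial.coeToMvPowerSeries.ringHom : MvPolynomial (Fin n) k →+* _)
  have hc : ∀ a : Fin n → ℕ, c (xPow k a) =
      MvPowerSeries.monomial (Finsupp.equivFunOnFinite.symm a) 1 := by
    intro a
    rw [xPow_eq_monomial]
    exact MvPolynomial.coe_monomial _ _
  let N : Finset (Fin n) := {i | d i = 0}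
  -- One more than the degree of `x ^ σ` in the variables of `Q_{d⁺}`, so that the error term in the
  -- `K`-th power of this prime cannot reach the monomial examined.
  let K := ∑ i ∈ N, σ i + 1
  rw [toCompletedLocalRing, ← Ideal.map_map] at h
  obtain ⟨s, hs, hmem⟩ :=
    CompletedLocalRing.exists_mul_mem_of_algebraMap_mem (coordPrime k d) _ _ h K
  have hU : ∀ l, IsUpperSet {c : Fin n →₀ ℕ | l ≤ ∑ i ∈ N, c i} :=
    fun l c c' hcc' hc => hc.trans (Finset.sum_le_sum fun i _ => hcc' i)
  have hQ : ∀ l, (coordPrime k d).asIdeal ^ l ≤ MvPowerSeries.supportedIdeal k _ (hU l) := by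
    intro l
    induction l with
    | zero => exact fun f _ c _ => Nat.zero_le _
    | succ l ih =>
      rw [pow_succ, Ideal.mul_le]
      intro f hf g hg e he
      have h1 : Ideal.span (varsOffSupport k d) ≤ MvPowerSeries.supportedIdeal k _ (hU 1) := by
        rw [Ideal.span_le]
        rintro _ ⟨j, hj, rfl⟩
        refine MvPowerSeries.monomial_mem_supportedIdeal (hU 1) ?_ 1
        have hjN : j ∈ N := by simpa [N] using hj
        refine le_trans ?_ (Finset.single_le_sum (fun _ _ => Nat.zero_le _) hjN)
        simp
      rw [MvPowerSeries.coeff_mul] at he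
      obtain ⟨⟨a, b⟩, hab, hne⟩ := Finset.exists_ne_zero_of_sum_ne_zero he
      rw [Finset.HasAntidiagonal.mem_antidiagonal] at hab
      simp only at hab hne
      have h2 := ih hf a (left_ne_zero_of_mul hne)
      have h3 := h1 hg b (right_ne_zero_of_mul hne)
      simp only [Set.mem_ofPred_eq] at h2 h3 ⊢
      rw [← hab]
      simp only [Finsupp.add_apply, Finset.sum_add_distrib]
      omega
  have hU' : IsUpperSet ({c : Fin n →₀ ℕ | ∃ μ, ∀ i, d i = 0 → m μ i ≤ c i} ∪
      {c : Fin n →₀ ℕ | K ≤ ∑ i ∈ N, c i}) := by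
    refine IsUpperSet.union ?_ (hU K)
    rintro c c' hcc' ⟨μ, hμ⟩
    exact ⟨μ, fun i hi => (hμ i hi).trans (hcc' i)⟩
  have hle : (Ideal.span (Set.range fun μ => xPow k (m μ))).map c ⊔ (coordPrime k d).asIdeal ^ K ≤
      MvPowerSeries.supportedIdeal k _ hU' := by
    refine sup_le ?_ fun f hf e he => Or.inr (hQ K hf e he)
    rw [Ideal.map_span, Ideal.span_le]
    rintro _ ⟨_, ⟨μ, rfl⟩, rfl⟩
    simp only [hc]
    exact MvPowerSeries.monomial_mem_supportedIdeal hU' (Or.inl ⟨μ, fun i _ => le_rfl⟩) 1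
  -- As `s` lies outside the prime, it has a monomial free of the variables in `N`; multiplying by
  -- it leaves the exponents of `σ` on `N` unchanged.
  obtain ⟨b, hb, hbs⟩ : ∃ b : Fin n →₀ ℕ, (∀ j, d j = 0 → b j = 0) ∧
      MvPowerSeries.coeff b s ≠ 0 := by
    by_contra hcon
    push Not at hcon
    apply hs
    have := mem_span_X_of_coeff_eq_zero N s (fun b hb => hcon b fun j hj => hb j (by simpa [N]))
    simpa [varsOffSupport, coordPrime, N] using this
  have hcoeff := hle hmem (b + Finsupp.equivFunOnFinite.symm σ) (by
    change MvPowerSeries.coeff _ (s * c (xPow k σ)) ≠ 0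
    rw [hc, MvPowerSeries.coeff_add_mul_monomial, mul_one]
    exact hbs)
  rcases hcoeff with ⟨μ, hμ⟩ | hK
  · refine ⟨μ, fun i hi => ?_⟩
    have := hμ i hi
    rwa [Finsupp.add_apply, hb i hi, zero_add] at this
  · exfalso
    have h0 : ∑ i ∈ N, (b + Finsupp.equivFunOnFinite.symm σ) i = ∑ i ∈ N, σ i := by
      refine Finset.sum_congr rfl fun i hi => ?_
      have hi' : d i = 0 := by simpa [N] using hi
      rw [Finsupp.add_apply, hb i hi', zero_add]
      rfl
    simp only [Set.mem_ofPred_eq, h0, K] at hK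
    omega

/-- A strict inequality at `i` would make `x ^ σ` divisible by `x i` times a generator, up to units,
hence an element of the maximal ideal times `J`. -/
theorem eq_of_isMinimalGenerator {r : ℕ} (m : Fin r → Fin n → ℕ) (σ : Fin n → ℕ)
    (h : IsMinimalGenerator
      ((Ideal.span (Set.range fun μ => xPow k (m μ))).map (toCompletedLocalRing k d))
      (toCompletedLocalRing k d (xPow k σ))) (μ : Fin r) (hμ : ∀ i, d i = 0 → m μ i ≤ σ i)
    (i : Fin n) (hi : d i = 0) : m μ i = σ i := by
  by_contra hne
  apply h.2
  have hlt : m μ i < σ i := lt_of_le_of_ne (hμ i hi) hne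
  have hdvd : toCompletedLocalRing k d (xPow k (Pi.single i 1 + m μ)) ∣
      toCompletedLocalRing k d (xPow k σ) := by
    refine toCompletedLocalRing_xPow_dvd d fun j hj => ?_
    rw [Pi.add_apply]
    by_cases hij : j = i
    · subst hij
      rw [Pi.single_eq_same]
      omega
    · rw [Pi.single_eq_of_ne hij, zero_add]
      exact hμ j hj
  refine Ideal.mem_of_dvd _ hdvd ?_
  rw [xPow_add, map_mul]
  refine Ideal.mul_mem_mul ?_ (Ideal.mem_map_of_mem _ (Ideal.subset_span ⟨μ, rfl⟩))
  have : xPow k (Pi.single i 1) = MvPolynomial.X i := by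
    rw [xPow, Finset.prod_eq_single i]
    · simp
    · intro j _ hj
      simp [hj]
    · simp
  rw [this, toCompletedLocalRing_X]
  exact CompletedLocalRing.algebraMap_mem_maximalIdeal (coordPrime k d)
    ((MvPowerSeries.X_mem_span_varsOffSupport_iff d i).2 hi)

end CoordPrime


/-! ### The critical exponent -/

section Critical

variable {n : ℕ} {d : Fin n → Fin 2}

/-- The traces of the sets of the family `𝒜` on the vertices `j` with `d j = 0`. -/
def traceFamily (d : Fin n → Fin 2) (𝒜 : Set (Finset (Fin n))) : Set (Finset {j // d j = 0}) :=
  (fun s => s.subtype (fun j => d j = 0)) '' 𝒜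

variable (𝒜 : Set (Finset (Fin n))) (σ : Fin n → ℕ) {p : ℕ} (hp : 2 ≤ p)

/-- The vertices, among those with `d j = 0`, at which `σ` takes the value `l`. -/
def levelSet (d : Fin n → Fin 2) (σ : Fin n → ℕ) (l : ℕ) : Finset {j // d j = 0} := {i | σ i = l}

theorem mem_levelSet (l : ℕ) (i : {j // d j = 0}) : i ∈ levelSet d σ l ↔ σ i = l := by
  simp [levelSet]

include hp

theorem disjoint_levelSet : Disjoint (levelSet d σ (p - 1)) (levelSet d σ p) := by
  rw [Finset.disjoint_left]
  intro i hi hi'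
  rw [mem_levelSet] at hi hi'
  omega

/-- Divisibility by a `p`-th power of a face only sees which of the levels `0`, `p - 1`, `p` occurs,
so it survives their replacement by `0`, `q - 1`, `q`. -/
theorem exists_blowExp_le (hσ : ∀ i, d i = 0 → σ i = 0 ∨ σ i = p - 1 ∨ σ i = p)
    (hmul : ∀ s ∈ 𝒜, ∃ s' ∈ 𝒜, ∀ i, d i = 0 → p * faceExp s' i ≤ σ i + faceExp s i)
    {q : ℕ} (s : Finset (Fin n)) (hs : s ∈ 𝒜) :
    ∃ s' ∈ 𝒜, ∀ i : {j // d j = 0},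
      q * faceExp s' i ≤ blowExp (levelSet d σ (p - 1)) (levelSet d σ p) q i + faceExp s i := by
  obtain ⟨s', hs', h⟩ := hmul s hs
  refine ⟨s', hs', fun i => ?_⟩
  have h1 := h i i.2
  have h2 := hσ i i.2
  simp only [blowExp, mem_levelSet]
  unfold faceExp at h1 ⊢
  split_ifs at h1 ⊢ <;> omega

/-- A smaller exponent `u` that still multiplies every face into the `q`-th Frobenius power can be
rounded to an exponent `a` doing so for `p`. Minimality of `σ` gives `a = σ` on the relevant
variables, and this pins down `u`. -/
theorem isCriticalExp_levelSet (hσ : ∀ i, d i = 0 → σ i = 0 ∨ σ i = p - 1 ∨ σ i = p)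
    (hmin : ∀ a : Fin n → ℕ,
      (∀ s ∈ 𝒜, ∃ s' ∈ 𝒜, ∀ i, p * faceExp s' i ≤ a i + faceExp s i) →
      (∀ i, d i = 0 → a i ≤ σ i) → ∀ i, d i = 0 → a i = σ i) {q : ℕ} (hq : 2 ≤ q) :
    IsCriticalExp (traceFamily d 𝒜) (levelSet d σ (p - 1)) (levelSet d σ p) q := by
  intro u hu hne
  by_contra hcon
  push Not at hcon
  -- Rounding by the thresholds `q - 1` and `q`; the value `p` at the inverted variables makes their
  -- condition automatic.
  let a : Fin n → ℕ := fun i =>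
    if h : d i = 0 then if u ⟨i, h⟩ < q - 1 then 0 else if u ⟨i, h⟩ = q - 1 then p - 1 else p else p
  have ha : ∀ i : {j // d j = 0}, a i = if u i < q - 1 then 0 else
      if u i = q - 1 then p - 1 else p := by
    rintro ⟨i, hi⟩
    simp only [a, hi, dif_pos]
  have hblow : ∀ i : {j // d j = 0}, blowExp (levelSet d σ (p - 1)) (levelSet d σ p) q i =
      if σ i = p then q else if σ i = p - 1 then q - 1 else 0 := by
    intro i
    simp only [blowExp, mem_levelSet]
  apply hne
  have hkey := hmin a (fun s hs => by
    have h1 := hcon _ ⟨s, hs, rfl⟩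
    unfold IsCover at h1
    push Not at h1
    obtain ⟨_, ⟨s', hs', rfl⟩, h1⟩ := h1
    refine ⟨s', hs', fun i => ?_⟩
    by_cases hi' : i ∈ s'
    · by_cases hi : d i = 0
      · have h2 := h1 ⟨i, hi⟩ (by simpa using hi')
        have h3 := ha ⟨i, hi⟩
        simp only [Finset.mem_filter, Finset.mem_univ, true_and, Finset.mem_subtype] at h2
        simp only [] at h3
        rw [h3]
        simp only [faceExp, if_pos hi']
        split_ifs at h2 ⊢ <;> omega
      · simp only [a, dif_neg hi, faceExp, if_pos hi']
        omega
    · simp [faceExp, hi']) (fun i hi => by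
    have h1 := hu ⟨i, hi⟩
    have h2 := hσ i hi
    have h3 := ha ⟨i, hi⟩
    rw [hblow] at h1
    simp only [] at h3 h1
    rw [h3]
    split_ifs at h1 ⊢ <;> omega)
  funext i
  have h1 := hkey i i.2
  have h2 := hu i
  have h3 := hσ i i.2
  rw [ha] at h1
  rw [hblow] at h2 ⊢
  split_ifs at h1 h2 ⊢ <;> omega

end Critical

/-! ### The variables in a completed local ring of the completed face ring -/

theorem monom_eq_mul_prod_not {ι B : Type*} [Fintype ι] [CommRing B] (P : ι → Prop)
    [DecidablePred P] (y : ι → B) (a : ι → ℕ) :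
    monom y a = monom (fun i : {j // P j} => y i) (fun i => a i) *
      ∏ i : {j // ¬ P j}, y i ^ a i :=
  (Fintype.prod_subtype_mul_prod_subtype P fun i => y i ^ a i).symm

theorem IsCartierMap.map_mul_mem {R : Type*} [CommRing R] {q : ℕ} {θ : R →+ R}
    (hθ : IsCartierMap q θ) (S : Set R) (a : R)
    (h : ∀ g ∈ S, ∃ g' ∈ S, g' ^ q ∣ a * g) (b : R) (hb : b ∈ Ideal.span S) :
    θ (a * b) ∈ Ideal.span S := by
  apply hθ.map_span_pow_le
  have hle : Ideal.span S ≤ Submodule.comap (LinearMap.mulLeft R a)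
      (Ideal.span ((fun a => a ^ q) '' ((Ideal.span S : Ideal R) : Set R))) := by
    rw [Ideal.span_le]
    intro g hg
    obtain ⟨g', hg', hdvd⟩ := h g hg
    change a * g ∈ Ideal.span _
    exact Ideal.mem_of_dvd _ hdvd (Ideal.subset_span ⟨g', Ideal.subset_span hg', rfl⟩)
  exact hle hb

section FaceRing

variable {n : ℕ} {k : Type*} [Field k]

theorem extendIdeal_eq {I : Ideal (MvPolynomial (Fin n) k)} {𝒜 : Set (Finset (Fin n))}
    (hI : I = Ideal.span ((fun s : Finset (Fin n) => ∏ i ∈ s, MvPolynomial.X i) '' 𝒜)) :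
    extendIdeal I = Ideal.span ((fun s => monom MvPowerSeries.X (faceExp s)) '' 𝒜) := by
  rw [extendIdeal, hI, Ideal.map_span, Set.image_image]
  congr 1
  refine Set.image_congr fun s _ => ?_
  rw [map_prod]
  simp only [MvPolynomial.coeToMvPowerSeries.ringHom_apply, MvPolynomial.coe_X]
  exact (monom_indicator _ s).symm

theorem monom_X_eq_monomial (a : Fin n → ℕ) : monom (MvPowerSeries.X (R := k)) a =
    MvPowerSeries.monomial (Finsupp.equivFunOnFinite.symm a) 1 := by
  have h := congrArg (MvPolynomial.coeToMvPowerSeries.ringHom (R := k)) (xPow_eq_monomial (k := k) a)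
  simpa [xPow, monom] using h

variable (I : Ideal (MvPolynomial (Fin n) k)) (P : PrimeSpectrum (CompletedFaceRing I))

/-- The image of the variable `x i` in the completed local ring of the completed face ring. -/
noncomputable def localVar (i : Fin n) : CompletedLocalRing P :=
  algebraMap (CompletedFaceRing I) _ (Ideal.Quotient.mk (extendIdeal I) (MvPowerSeries.X i))

theorem algebraMap_mk_monom (a : Fin n → ℕ) :
    algebraMap (CompletedFaceRing I) (CompletedLocalRing P)
      (Ideal.Quotient.mk (extendIdeal I) (monom MvPowerSeries.X a)) = monom (localVar I P) a := by
  simp [monom, localVar, map_prod]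

variable {d : Fin n → Fin 2}

theorem associated_monom_localVar
    (hd : ∀ i, d i ≠ 0 → IsUnit (localVar I P i)) (a : Fin n → ℕ) :
    Associated (monom (localVar I P) a)
      (monom (fun i : {j // d j = 0} => localVar I P i) (fun i => a i)) := by
  rw [monom_eq_mul_prod_not (fun j => d j = 0)]
  refine associated_mul_unit_left _ _ ?_
  exact IsUnit.prod_univ_iff.2 fun i => (hd i i.2).pow _

/-- For regularity, the hypothesis on `T` puts every face monomial in the ideal of powers, so the
quotient is one of the power series ring itself. There `x j` is regular by inspection of monomials,
and flatness carries this to the completed local ring. -/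
theorem isFaceSystem_localVar {𝒜 : Set (Finset (Fin n))}
    (hI : I = Ideal.span ((fun s : Finset (Fin n) => ∏ i ∈ s, MvPolynomial.X i) '' 𝒜))
    (hd : ∀ i, d i ≠ 0 → IsUnit (localVar I P i)) :
    IsFaceSystem (traceFamily d 𝒜) (fun i : {j // d j = 0} => localVar I P i) := by
  constructor
  · rintro _ ⟨s, hs, rfl⟩
    have h0 : monom (localVar I P) (faceExp s) = 0 := by
      rw [← algebraMap_mk_monom, Ideal.Quotient.eq_zero_iff_mem.2, map_zero]
      rw [extendIdeal_eq hI]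
      exact Ideal.subset_span ⟨s, hs, rfl⟩
    have h1 := (associated_monom_localVar I P hd (faceExp s)).dvd
    rw [h0, zero_dvd_iff] at h1
    rw [← monom_indicator, ← h1]
    congr 1
    funext i
    simp [faceExp]
  · intro T a j hj hT r hr
    let a' : Fin n → ℕ := fun i => if h : d i = 0 then a ⟨i, h⟩ else 0
    have ha' : ∀ i : {j // d j = 0}, a' i = a i := by
      rintro ⟨i, hi⟩
      simp only [a', hi, dif_pos]
    let T' : Finset (Fin n) := T.map (Function.Embedding.subtype _)
    let 𝔟 : Ideal (MvPowerSeries (Fin n) k) :=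
      Ideal.span ((fun i => (MvPowerSeries.X i : MvPowerSeries (Fin n) k) ^ a' i) '' T')
    have hle : extendIdeal I ≤ 𝔟 := by
      rw [extendIdeal_eq hI, Ideal.span_le]
      rintro _ ⟨s, hs, rfl⟩
      obtain ⟨i, his, hiT, hia⟩ := hT _ ⟨s, hs, rfl⟩
      refine Ideal.mem_of_dvd _ (pow_dvd_monom _ (i := (i : Fin n)) (a := a' i) ?_)
        (Ideal.subset_span ⟨i, by simp [T', i.2, hiT], rfl⟩)
      rw [ha', faceExp, if_pos (by simpa using his)]
      exact hia
    have hmap : (𝔟.map (Ideal.Quotient.mk (extendIdeal I))).map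
        (algebraMap (CompletedFaceRing I) (CompletedLocalRing P)) =
        Ideal.span ((fun i : {j // d j = 0} => localVar I P i ^ a i) '' (T : Set _)) := by
      rw [Ideal.map_span, Ideal.map_span, Set.image_image, Set.image_image, Finset.coe_map,
        Set.image_image]
      congr 1
      refine Set.image_congr fun i _ => ?_
      simp only [Function.Embedding.subtype_apply, ha', map_pow, localVar]
    rw [← hmap] at hr ⊢
    refine Ideal.mem_map_of_mul_mem_map_of_flat _ _ (fun z hz => ?_) r hr
    obtain ⟨z, rfl⟩ := Ideal.Quotient.mk_surjective z
    rw [← map_mul, Ideal.mem_quotient_iff_mem hle] at hz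
    rw [Ideal.mem_quotient_iff_mem hle]
    exact MvPowerSeries.mem_span_X_pow_of_X_mul_mem T' a' j (by simpa [T'] using fun _ => hj) z hz

/-- Premultiplication by the `blowExp` monomial makes the coefficient map preserve the face ideal.
It sends the `coExp` monomial to the product over `V₂` because the exponents sum to `q` times the
indicator of `V₂`, plus `q - 1`. -/
theorem exists_isCartierMap_localVar {𝒜 : Set (Finset (Fin n))}
    (hI : I = Ideal.span ((fun s : Finset (Fin n) => ∏ i ∈ s, MvPolynomial.X i) '' 𝒜))
    (hd : ∀ i, d i ≠ 0 → IsUnit (localVar I P i)) (p : ℕ) [Fact p.Prime] [CharP k p] (e : ℕ)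
    {V₁ V₂ : Finset {j // d j = 0}} (h12 : Disjoint V₁ V₂)
    (hmul : ∀ s ∈ 𝒜, ∃ s' ∈ 𝒜, ∀ i : {j // d j = 0},
      p ^ e * faceExp s' i ≤ blowExp V₁ V₂ (p ^ e) i + faceExp s i) :
    ∃ θ : CompletedLocalRing P →+ CompletedLocalRing P, IsCartierMap (p ^ e) θ ∧
      Associated (θ (monom (fun i : {j // d j = 0} => localVar I P i) (coExp V₁ (p ^ e))))
        (∏ i ∈ V₂, localVar I P i) := by
  have hq : 1 ≤ p ^ e := Nat.one_le_pow _ _ (Fact.out : p.Prime).pos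
  generalize hqe : p ^ e = q at *
  let lift : ({j // d j = 0} → ℕ) → ℕ → Fin n → ℕ := fun a b i =>
    if h : d i = 0 then a ⟨i, h⟩ else b
  have hlift : ∀ a b (i : {j // d j = 0}), lift a b i = a i := by
    rintro a b ⟨i, hi⟩
    simp only [lift, hi, dif_pos]
  have hlift' : ∀ a b i, d i ≠ 0 → lift a b i = b := by
    intro a b i hi
    simp only [lift, dif_neg hi]
  let v := lift (fun i => if i ∈ V₂ then 1 else 0) 1
  let ρ := lift (fun _ => q - 1) 0
  obtain ⟨θ₀, hθ₀, hmon⟩ := MvPowerSeries.exists_isCartierMap (k := k) p e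
    (Finsupp.equivFunOnFinite.symm ρ) (fun i => by
      rw [hqe]
      change (if h : d i = 0 then q - 1 else 0) < q
      split_ifs <;> omega)
  rw [hqe] at hθ₀ hmon
  -- Exponent `q` at the inverted variables ensures divisibility by `q`-th powers there; it leaves
  -- one unit factor per variable in the value, recorded by `v`.
  let w : MvPowerSeries (Fin n) k := monom MvPowerSeries.X (lift (blowExp V₁ V₂ q) q)
  obtain ⟨θ₁, hθ₁, h₁⟩ := (hθ₀.comp_mulLeft w).exists_quotient (extendIdeal I) (by
    rw [extendIdeal_eq hI]
    refine hθ₀.map_mul_mem _ w ?_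
    rintro _ ⟨s, hs, rfl⟩
    obtain ⟨s', hs', hle⟩ := hmul s hs
    refine ⟨_, ⟨s', hs', rfl⟩, ?_⟩
    simp only [w]
    rw [← monom_add, ← monom_mul]
    apply monom_dvd
    intro i
    rw [Pi.add_apply]
    by_cases hi : d i = 0
    · have := hle ⟨i, hi⟩
      rwa [← hlift (blowExp V₁ V₂ q) q] at this
    · rw [hlift' _ _ _ hi]
      unfold faceExp
      split_ifs <;> omega)
  obtain ⟨θ, hθ, h⟩ := CompletedLocalRing.exists_isCartierMap P hq hθ₁
  refine ⟨θ, hθ, ?_⟩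
  have hτ : monom (fun i : {j // d j = 0} => localVar I P i) (coExp V₁ q) =
      monom (localVar I P) (lift (coExp V₁ q) 0) := by
    rw [monom_eq_mul_prod_not (fun j => d j = 0), Finset.prod_eq_one, mul_one]
    · simp only [hlift]
    · rintro ⟨i, hi⟩ -
      rw [hlift' _ _ _ hi, pow_zero]
  have hexp : lift (blowExp V₁ V₂ q) q + lift (coExp V₁ q) 0 = fun i => q * v i + ρ i := by
    funext i
    rw [Pi.add_apply]
    by_cases hi : d i = 0
    · have h1 := blowExp_add_coExp h12 hq ⟨i, hi⟩
      have h2 : ∀ a b, lift a b i = a ⟨i, hi⟩ := fun a b => hlift a b ⟨i, hi⟩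
      simp only [v, ρ, h2]
      unfold nilExp at h1
      split_ifs at h1 ⊢ <;> omega
    · simp only [v, ρ, hlift' _ _ _ hi]
      omega
  have hval : θ₀ (w * monom MvPowerSeries.X (lift (coExp V₁ q) 0)) = monom MvPowerSeries.X v := by
    simp only [w]
    rw [← monom_add, hexp, monom_X_eq_monomial, monom_X_eq_monomial]
    have hsum : (Finsupp.equivFunOnFinite.symm fun i => q * v i + ρ i) =
        q • Finsupp.equivFunOnFinite.symm v + Finsupp.equivFunOnFinite.symm ρ := by
      ext i
      simp
    rw [hsum, hmon]
  have hfinal : θ (monom (localVar I P) (lift (coExp V₁ q) 0)) = monom (localVar I P) v := by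
    rw [← algebraMap_mk_monom, h, h₁, ← algebraMap_mk_monom]
    exact congrArg _ (congrArg _ hval)
  rw [hτ, hfinal, ← monom_indicator (fun i : {j // d j = 0} => localVar I P i) V₂]
  have := associated_monom_localVar I P hd v
  simp only [v, hlift] at this
  exact this

end FaceRing
-- From the minimal generator to the criterion
theorem theorem2p8 {k : Type*} [Field k] (p : ℕ) [Fact p.Prime] [CharP k p] (n : ℕ)
    (I : Ideal (MvPolynomial (Fin n) k)) (hI : IsFaceIdeal I)
    (β : Fin n → Fin 2) (r : ℕ) (m : Fin r → Fin n → ℕ)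
    (hm : ∀ μ, (∀ j, m μ j = 0 ∨ m μ j = p - 1 ∨ m μ j = p) ∧
      (∃ i, m μ i = p) ∧ (∃ j, m μ j = p - 1))
    (J : Ideal (MvPolynomial (Fin n) k))
    (hJ : J = Ideal.span (Set.range fun μ => xPow k (m μ)))
    (hcolon : (frobeniusPower I p).colon (I : Set (MvPolynomial (Fin n) k)) =
      frobeniusPower I p ⊔ J ⊔ Ideal.span {xPow k (fun i => (β i : ℕ)) ^ (p - 1)})
    (d : Fin n → Fin 2) (σ : Fin n → ℕ)
    (hσgen : IsMinimalGenerator (J.map (toCompletedLocalRing k d))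
      (toCompletedLocalRing k d (xPow k σ)))
    (hσ : ∃ a b c, σ a = 0 ∧ σ b = p - 1 ∧ σ c = p ∧ d c = 0)
    (hσnot : toCompletedLocalRing k d (xPow k σ) ∉
      (frobeniusPower I p ⊔ Ideal.span {xPow k (fun i => (β i : ℕ)) ^ (p - 1)}).map
        (toCompletedLocalRing k d)) :
    PrimeSpectrum.comap (Ideal.Quotient.mk (extendIdeal I)) ⁻¹'
        (stratum k d ∩ PrimeSpectrum.zeroLocus (extendIdeal I)) ⊆
      (fgLocus p (CompletedFaceRing I))ᶜ := by
  obtain ⟨𝒜, hI⟩ := hI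
  obtain ⟨-, -, c, -, -, hσc, hdc⟩ := hσ
  subst hJ
  have hp : 2 ≤ p := (Fact.out : p.Prime).two_le
  have hnot : ∀ a : Fin n → ℕ, (∀ i, d i = 0 → a i ≤ σ i) →
      xPow k a ∉ frobeniusPower I p ⊔ Ideal.span {xPow k (fun i => (β i : ℕ)) ^ (p - 1)} :=
    fun a ha hmem => hσnot
      (Ideal.mem_of_dvd _ (toCompletedLocalRing_xPow_dvd d ha) (Ideal.mem_map_of_mem _ hmem))
  obtain ⟨μ, hμ⟩ := exists_le_of_toCompletedLocalRing_xPow_mem d m σ hσgen.1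
  have hμ := eq_of_isMinimalGenerator d m σ hσgen μ hμ
  have hσ012 : ∀ i, d i = 0 → σ i = 0 ∨ σ i = p - 1 ∨ σ i = p := fun i hi =>
    hμ i hi ▸ (hm μ).1 i
  have hmul : ∀ s ∈ 𝒜, ∃ s' ∈ 𝒜, ∀ i, d i = 0 → p * faceExp s' i ≤ σ i + faceExp s i := by
    have h := (xPow_mem_sup_iff p 𝒜 I hI β m (m μ)).2 (Or.inr (Or.inl ⟨μ, fun i => le_rfl⟩))
    rw [← hcolon, xPow_mem_colon_iff p 𝒜 I hI] at h
    intro s hs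
    obtain ⟨s', hs', h⟩ := h s hs
    exact ⟨s', hs', fun i hi => hμ i hi ▸ h i⟩
  -- A colon monomial below `σ` cannot come from the Frobenius power or from `β`, so some `m ν`
  -- divides it; minimality of the generator forces equality on the variables of the prime.
  have hmin : ∀ a : Fin n → ℕ,
      (∀ s ∈ 𝒜, ∃ s' ∈ 𝒜, ∀ i, p * faceExp s' i ≤ a i + faceExp s i) →
      (∀ i, d i = 0 → a i ≤ σ i) → ∀ i, d i = 0 → a i = σ i := by
    intro a ha haσ i hi
    rw [← xPow_mem_colon_iff (k := k) p 𝒜 I hI, hcolon, xPow_mem_sup_iff p 𝒜 I hI] at ha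
    rcases ha with h | ⟨ν, h⟩ | h
    · exact absurd (Ideal.mem_sup_left h) (hnot a haσ)
    · have h1 := eq_of_isMinimalGenerator d m σ hσgen ν (fun i hi => (h i).trans (haσ i hi)) i hi
      exact le_antisymm (haσ i hi) (h1 ▸ h i)
    · refine absurd (Ideal.mem_sup_right (Ideal.mem_span_singleton_self _)) (xPow_pow (k := k) _ _ ▸
        hnot _ fun i hi => (h i).trans (haσ i hi))
  -- A face with trace inside `V₂` would have its `p`-th power divide `x ^ σ` up to units, against
  -- `hσnot`.
  have hcov : IsCover (traceFamily d 𝒜) (levelSet d σ p)ᶜ := by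
    rintro _ ⟨s, hs, rfl⟩
    by_contra hcon
    push Not at hcon
    refine hnot (fun i => p * faceExp s i) (fun i hi => ?_) (Ideal.mem_sup_left
      ((xPow_mem_frobeniusPower_iff p 𝒜 I hI _).2 ⟨s, hs, fun i => le_rfl⟩))
    unfold faceExp
    split_ifs with his
    · have := hcon ⟨i, hi⟩ (by simpa using his)
      rw [Finset.mem_compl, not_not, mem_levelSet] at this
      rw [this, mul_one]
    · simp
  intro P hP hfg
  have hmemP : ∀ i, Ideal.Quotient.mk (extendIdeal I) (MvPowerSeries.X i) ∈ P.asIdeal ↔ d i = 0 := by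
    intro i
    constructor
    · intro hmem
      by_contra hi
      refine hP.1.1 ?_
      change Ideal.Quotient.mk (extendIdeal I) _ ∈ P.asIdeal
      rw [map_prod]
      refine Ideal.mem_of_dvd _ (Finset.dvd_prod_of_mem _ (Finset.mem_univ i)) ?_
      have : (d i : ℕ) = 1 := by
        have := (d i).isLt
        have h0 : (d i : ℕ) ≠ 0 := fun h => hi (Fin.ext h)
        omega
      rwa [this, pow_one]
    · intro hi
      exact hP.1.2 ⟨i, hi, rfl⟩
  have hd : ∀ i, d i ≠ 0 → IsUnit (localVar I P i) := fun i hi =>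
    CompletedLocalRing.isUnit_algebraMap P (mt (hmemP i).1 hi)
  refine (isFaceSystem_localVar I P hI hd).not_hasFGFrobeniusAlgebra
    (fun i => CompletedLocalRing.algebraMap_mem_maximalIdeal P ((hmemP i).2 i.2))
    (disjoint_levelSet σ hp) hcov ⟨⟨c, hdc⟩, (mem_levelSet σ p _).2 hσc⟩ hp
    (fun e he => isCriticalExp_levelSet 𝒜 σ hp hσ012 hmin
      (hp.trans (Nat.le_self_pow (by omega) p)))
    (fun e he => exists_isCartierMap_localVar I P hI hd p e (disjoint_levelSet σ hp)
      (exists_blowExp_le 𝒜 σ hp hσ012 hmul)) hfg
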